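/- **Theorem 4.1 (index-finding lower bounds).** Distributions are over $[n]=\{1,\dots,n\}$, $d_{\mathrm{TV}}(P,Q)=\frac12\sum_{x}|P(x)-Q(x)|$, and $U$ is the uniform distribution on $[n]$. Let $D_1,\dots,D_k$ be distributions such that, for an unknown set $\mathcal I\subseteq[k]$ of size $r$, $D_i=P$ for $i\in\mathcal I$ and $D_i=Q$ for $i\notin\mathcal I$, where $d_{\mathrm{TV}}(P,Q)\ge\varepsilon$. A (randomized) algorithm repeatedly chooses an index $i\in[k]$, adaptively as a function of its internal randomness and all previous samples, and receives a fresh independent sample from $D_i$; eventually it stops and outputs an index. It may know $n,k,r$ and $\varepsilon$. For every $\delta>0$ there is a constant $c>0$, depending only on $\delta$, such that for all integers $n\ge2$, $k\ge60$, $1\le r\le k/60$, all $0<\varepsilon\le1-\delta$, and every integer $T\ge 0$ the following hold for every such algorithm that always draws at most $T$ samples in total. (a) (One known) If $\varepsilon\le 1-\frac1n$ and, for $Q=U$, for every $\mathcal I$ of size $r$ and every $P$ with $d_{\mathrm{TV}}(P,U)\ge\varepsilon$, the algorithm outputs an element of $\mathcal I$ with probability at least $0.9$, then $$T\ \ge\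 c\,\frac{k\sqrt n}{r\varepsilon^2}.$$ (b) (Both unknown) If, for every $\mathcal I$ of size $r$ and all $P,Q$ with $d_{\mathrm{TV}}(P,Q)\ge\varepsilon$, the algorithm outputs an element of $\mathcal I$ with probability at least $0.9$, then $$T\ \ge\ c\,\max\left\{\frac{k\sqrt n}{r\varepsilon^2},\ \left(\frac{nk}{r\varepsilon^2}\right)^{2/3}\right\}.$$ In particular, with $\delta=\frac12$, the lower bounds hold with a universal constant for all $\varepsilon\le\frac12$ and all $n\ge2$. -/

import Mathlib

/-- Total variation distance `½ ∑ₓ |P(x) - Q(x)|` of two distributions on `[n]`. -/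
noncomputable def tvDist {n : ℕ} (P Q : PMF (Fin n)) : ℝ :=
  (1 / 2) * ∑ x : Fin n, |(P x).toReal - (Q x).toReal|

/-- A deterministic adaptive algorithm with sample access to `k` distributions on `[n]` whose
output is an index in `[k]`.  It either stops and outputs `i`, or draws a fresh sample from the
`i`-th distribution and continues in a way that may depend on everything seen so far. -/
inductive SampleTree (k n : ℕ) : Type
  | output (i : Fin k) : SampleTree k n
  | query (i : Fin k) (next : Fin n → SampleTree k n) : SampleTree k n

/-- The largest number of samples that a deterministic adaptive algorithm can draw. -/
def SampleTree.depth {k n : ℕ} : SampleTree k n → ℕ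
  | .output _ => 0
  | .query _ next => 1 + Finset.univ.sup (fun x => (next x).depth)

/-- The law of the output when the `k` sampled distributions are `D 0, …, D (k - 1)`;
every query to `i` returns a fresh independent sample from `D i`. -/
noncomputable def SampleTree.run {k n : ℕ} (D : Fin k → PMF (Fin n)) :
    SampleTree k n → PMF (Fin k)
  | .output i => PMF.pure i
  | .query i next => (D i).bind (fun x => (next x).run D)

/-- A randomized adaptive algorithm: the internal randomness selects a deterministic adaptive
algorithm.  (There are only countably many of these, so a `PMF` is the most general law.) -/
abbrev RandomizedAlgorithm (k n : ℕ) : Type := PMF (SampleTree k n)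

/-- The algorithm never draws more than `T` samples in total. -/
def RandomizedAlgorithm.UsesAtMost {k n : ℕ} (A : RandomizedAlgorithm k n) (T : ℕ) : Prop :=
  ∀ t ∈ A.support, t.depth ≤ T

/-- The law of the output over the internal randomness and the samples. -/
noncomputable def RandomizedAlgorithm.run {k n : ℕ} (A : RandomizedAlgorithm k n)
    (D : Fin k → PMF (Fin n)) : PMF (Fin k) :=
  PMF.bind A (fun t => t.run D)

/-- The instance with `D i = P` for `i ∈ I` and `D i = Q` for `i ∉ I`. -/
noncomputable def clusterInstance {k n : ℕ} (I : Finset (Fin k)) (P Q : PMF (Fin n)) :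
    Fin k → PMF (Fin n) :=
  fun i => if i ∈ I then P else Q

/-- On the instance `(I, P, Q)` the algorithm returns an index in `I` with probability
at least `0.9`. -/
def RandomizedAlgorithm.FindsIndex {k n : ℕ} (A : RandomizedAlgorithm k n)
    (I : Finset (Fin k)) (P Q : PMF (Fin n)) : Prop :=
  (9 / 10 : ℝ) ≤ ∑ i ∈ I, (A.run (clusterInstance I P Q) i).toReal

/-- Index finding when the larger cluster is known to have the uniform distribution: success on
every instance whose cluster `I` has size `r` and law `P` at distance at least `ε` from uniform. -/
def RandomizedAlgorithm.SolvesOneKnown {k n : ℕ} [NeZero n] (A : RandomizedAlgorithm k n)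
    (r : ℕ) (ε : ℝ) : Prop :=
  ∀ (I : Finset (Fin k)) (P : PMF (Fin n)), I.card = r →
    ε ≤ tvDist P (PMF.uniformOfFintype (Fin n)) →
    A.FindsIndex I P (PMF.uniformOfFintype (Fin n))

/-- Index finding when both distributions are unknown: success on every instance whose cluster
`I` has size `r` and whose two laws are at distance at least `ε`. -/
def RandomizedAlgorithm.SolvesBothUnknown {k n : ℕ} (A : RandomizedAlgorithm k n)
    (r : ℕ) (ε : ℝ) : Prop :=
  ∀ (I : Finset (Fin k)) (P Q : PMF (Fin n)), I.card = r →
    ε ≤ tvDist P Q → A.FindsIndex I P Q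

/-!
Write `q = ⌊k / r⌋` and hide `q` disjoint candidate sets of `r` indices. An algorithm with `T`
samples that finds the right candidate gives a test between "short tape from `P`, long tape from
`Q`" and the same with the two tapes exchanged: for most candidates the indices of the candidate
are sampled only `m ≈ T / q` times. It remains to choose random `P` and `Q` for which no test on
an `m`-tape and a `T`-tape succeeds.

(a) Split `[n]` into blocks of bounded size and let `P` put a peak at a random point of each block.
The second moment of the likelihood ratio is the exponential moment of the overlap of two
independent choices of peaks, which stays bounded while `m ε² ≪ √n`.

(b) The `n ^ (2/3)` bound arises because `Q` may be irregular. Give a random set of `K ≈ T` blocks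
uniform mass `η ≈ 1 / T` per block, and spread mass `ε` lightly over the others. Collisions inside
light blocks, which reveal the peaks of `P`, are masked by collisions inside heavy blocks.
-/
open Finset Function
open scoped BigOperators

section IidSum

variable {α κ : Type*} [Fintype α]

/-- The expectation of `F` over `m` independent draws from the law with weights `p`. The weights
need not be nonnegative nor sum to one. -/
def iidSum (p : α → ℝ) (m : ℕ) (F : (Fin m → α) → ℝ) : ℝ :=
  ∑ xs : Fin m → α, (∏ s, p (xs s)) * F xs

theorem iidSum_zero (p : α → ℝ) (F : (Fin 0 → α) → ℝ) : iidSum p 0 F = F Fin.elim0 := by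
  simp [iidSum, Subsingleton.elim (default : Fin 0 → α) Fin.elim0]

theorem iidSum_succ (p : α → ℝ) (m : ℕ) (F : (Fin (m + 1) → α) → ℝ) :
    iidSum p (m + 1) F = ∑ x, p x * iidSum p m fun xs => F (Fin.cons x xs) := by
  simp only [iidSum]
  rw [← (Fin.consEquiv fun _ : Fin (m + 1) => α).sum_comp, Fintype.sum_prod_type]
  simp [Fin.consEquiv, Fin.prod_univ_succ, mul_assoc, mul_sum]

theorem iidSum_prod (p : α → ℝ) {m : ℕ} (f : Fin m → α → ℝ) :
    iidSum p m (fun xs => ∏ s, f s (xs s)) = ∏ s, ∑ x, p x * f s x := by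
  simp only [iidSum, ← prod_mul_distrib, Finset.prod_univ_sum, Fintype.piFinset_univ]

theorem iidSum_const {p : α → ℝ} (hp : ∑ x, p x = 1) (m : ℕ) (c : ℝ) :
    iidSum p m (fun _ => c) = c := by
  rw [iidSum, ← sum_mul]
  simpa [iidSum, hp] using congrArg (· * c) (iidSum_prod p fun (_ : Fin m) _ => 1)

theorem mul_iidSum (p : α → ℝ) (m : ℕ) (c : ℝ) (F : (Fin m → α) → ℝ) :
    c * iidSum p m F = iidSum p m fun xs => c * F xs := by
  simp only [iidSum, mul_sum, mul_left_comm]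

theorem sum_iidSum (s : Finset κ) (p : α → ℝ) (m : ℕ) (F : κ → (Fin m → α) → ℝ) :
    ∑ y ∈ s, iidSum p m (F y) = iidSum p m fun xs => ∑ y ∈ s, F y xs := by
  simp only [iidSum, mul_sum]
  exact sum_comm

theorem iidSum_mul_weight (p L : α → ℝ) (m : ℕ) (F : (Fin m → α) → ℝ) :
    iidSum (fun x => p x * L x) m F = iidSum p m fun xs => (∏ s, L (xs s)) * F xs := by
  simp only [iidSum, prod_mul_distrib, mul_assoc]

theorem iidSum_mono {p : α → ℝ} (hp : ∀ x, 0 ≤ p x) {m : ℕ} {F G : (Fin m → α) → ℝ}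
    (h : ∀ xs, F xs ≤ G xs) : iidSum p m F ≤ iidSum p m G :=
  sum_le_sum fun xs _ => mul_le_mul_of_nonneg_left (h xs) (prod_nonneg fun _ _ => hp _)

/-- The expectation of `G` over a tape of `m` draws from `p` and an independent tape of `T` draws
from `q`. -/
def twoTapeSum (p : α → ℝ) (m : ℕ) (q : α → ℝ) (T : ℕ) (G : (Fin m → α) → (Fin T → α) → ℝ) : ℝ :=
  iidSum p m fun xs => iidSum q T fun ys => G xs ys

theorem twoTapeSum_const {p q : α → ℝ} (hp : ∑ x, p x = 1) (hq : ∑ x, q x = 1) (m T : ℕ) (c : ℝ) :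
    twoTapeSum p m q T (fun _ _ => c) = c := by
  simp only [twoTapeSum, iidSum_const hp, iidSum_const hq]

theorem twoTapeSum_succ_left (p q : α → ℝ) (m T : ℕ)
    (G : (Fin (m + 1) → α) → (Fin T → α) → ℝ) :
    twoTapeSum p (m + 1) q T G =
      ∑ x, p x * twoTapeSum p m q T fun xs ys => G (Fin.cons x xs) ys := by
  simp only [twoTapeSum, iidSum_succ]

theorem twoTapeSum_succ_right (p q : α → ℝ) (m T : ℕ)
    (G : (Fin m → α) → (Fin (T + 1) → α) → ℝ) :
    twoTapeSum p m q (T + 1) G =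
      ∑ y, q y * twoTapeSum p m q T fun xs ys => G xs (Fin.cons y ys) := by
  simp only [twoTapeSum, iidSum_succ, mul_iidSum, sum_iidSum]

end IidSum

section PMFAverage

variable {α : Type*}

theorem sum_toReal_eq_one [Fintype α] (p : PMF α) : ∑ x, (p x).toReal = 1 := by
  rw [← ENNReal.toReal_sum fun x _ => p.apply_ne_top x, ← tsum_fintype (L := .unconditional _),
    p.tsum_coe, ENNReal.toReal_one]

theorem sum_toReal_mul_le [Fintype α] (p : PMF α) {f : α → ℝ} {c : ℝ} (h : ∀ x, f x ≤ c) :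
    ∑ x, (p x).toReal * f x ≤ c :=
  calc ∑ x, (p x).toReal * f x ≤ ∑ x, (p x).toReal * c := by gcongr with x; exact h x
    _ = c := by rw [← sum_mul, sum_toReal_eq_one, one_mul]

theorem mul_sum_toReal_mul_le [Fintype α] (p : PMF α) {f g h : α → ℝ} {a c : ℝ}
    (hf : ∀ x, a * f x ≤ a * g x + h x + c) :
    a * ∑ x, (p x).toReal * f x ≤
      a * ∑ x, (p x).toReal * g x + ∑ x, (p x).toReal * h x + c := by
  have := sum_toReal_mul_le p (c := c) (f := fun x => a * f x - a * g x - h x)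
    fun x => by linarith [hf x]
  simp only [mul_sub, sum_sub_distrib, mul_left_comm _ a, ← mul_sum] at this
  linarith

theorem exists_pmf_toReal_eq [Fintype α] {p : α → ℝ} (h0 : ∀ x, 0 ≤ p x) (h1 : ∑ x, p x = 1) :
    ∃ P : PMF α, ∀ x, (P x).toReal = p x :=
  ⟨PMF.ofFintype (fun x => ENNReal.ofReal (p x)) (by
    rw [← ENNReal.ofReal_sum_of_nonneg fun x _ => h0 x, h1, ENNReal.ofReal_one]),
    fun x => by simp [ENNReal.toReal_ofReal (h0 x)]⟩

theorem exists_mem_support_le_of_le_tsum (p : PMF α) {f : α → ENNReal} {c : ENNReal} (hc : c ≠ ⊤)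
    (h : c ≤ ∑' a, p a * f a) : ∃ a ∈ p.support, c ≤ f a := by
  by_contra! hlt
  obtain ⟨a₀, ha₀⟩ := p.support_nonempty
  have hle (a : α) : p a * f a ≤ p a * c := by
    by_cases ha : a ∈ p.support
    · gcongr
      exact (hlt a ha).le
    · simp [(p.apply_eq_zero_iff a).2 ha]
  have htot : ∑' a, p a * c = c := by rw [ENNReal.tsum_mul_right, p.tsum_coe, one_mul]
  refine h.not_gt <| htot ▸ ENNReal.tsum_lt_tsum (i := a₀) ?_ hle
    (ENNReal.mul_lt_mul_right ((p.mem_support_iff _).1 ha₀) (p.apply_ne_top _) (hlt a₀ ha₀))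
  exact ne_top_of_le_ne_top (htot.symm ▸ hc) (ENNReal.tsum_le_tsum hle)

end PMFAverage

/-! ### From algorithms to tests on two tapes -/

namespace SampleTree

variable {k n : ℕ}

/-- The probability that the output lies in `I`. -/
noncomputable def success (D : Fin k → PMF (Fin n)) (I : Finset (Fin k)) (t : SampleTree k n) : ℝ :=
  ∑ i ∈ I, (t.run D i).toReal

/-- The expected number of samples drawn from the distributions with index in `I`. -/
noncomputable def expQueries (D : Fin k → PMF (Fin n)) (I : Finset (Fin k)) : SampleTree k n → ℝ
  | .output _ => 0
  | .query i next => (if i ∈ I then 1 else 0) + ∑ x, (D i x).toReal * (next x).expQueries D I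

theorem depth_next_lt (i : Fin k) (next : Fin n → SampleTree k n) (x : Fin n) :
    (next x).depth < (query i next).depth := by
  have := le_sup (f := fun x => (next x).depth) (mem_univ x)
  simp only [depth]
  omega

theorem success_output (D : Fin k → PMF (Fin n)) (I : Finset (Fin k)) (i : Fin k) :
    (output i : SampleTree k n).success D I = if i ∈ I then 1 else 0 := by
  have h (j : Fin k) : (PMF.pure i j).toReal = if j = i then 1 else 0 := by
    rw [PMF.pure_apply]
    split_ifs <;> simp
  simp only [success, run, h, sum_ite_eq']

theorem success_query (D : Fin k → PMF (Fin n)) (I : Finset (Fin k)) (i : Fin k)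
    (next : Fin n → SampleTree k n) :
    (query i next).success D I = ∑ x, (D i x).toReal * (next x).success D I := by
  simp only [success, run, mul_sum]
  rw [sum_comm]
  refine sum_congr rfl fun j _ => ?_
  rw [PMF.bind_apply, tsum_fintype, ENNReal.toReal_sum]
  · simp only [ENNReal.toReal_mul]
  · exact fun x _ => ENNReal.mul_ne_top (PMF.apply_ne_top _ _) (PMF.apply_ne_top _ _)

theorem success_nonneg (D : Fin k → PMF (Fin n)) (I : Finset (Fin k)) (t : SampleTree k n) :
    0 ≤ t.success D I :=
  sum_nonneg fun _ _ => ENNReal.toReal_nonneg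

theorem success_le_one (D : Fin k → PMF (Fin n)) (I : Finset (Fin k)) (t : SampleTree k n) :
    t.success D I ≤ 1 :=
  (sum_le_univ_sum_of_nonneg fun _ => ENNReal.toReal_nonneg).trans_eq (sum_toReal_eq_one _)

theorem expQueries_nonneg (D : Fin k → PMF (Fin n)) (I : Finset (Fin k)) (t : SampleTree k n) :
    0 ≤ t.expQueries D I := by
  induction t with
  | output _ => exact le_rfl
  | query i next ih =>
    exact add_nonneg (by split_ifs <;> simp)
      (sum_nonneg fun x _ => mul_nonneg ENNReal.toReal_nonneg (ih x))

section Disjoint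

variable {ι : Type*} [Fintype ι] {I : ι → Finset (Fin k)}

theorem sum_indicator_le_one (hI : Pairwise (Disjoint on I)) (i : Fin k) :
    ∑ j, (if i ∈ I j then (1 : ℝ) else 0) ≤ 1 := by
  rw [sum_boole]
  norm_cast
  refine card_le_one.2 fun j hj j' hj' => ?_
  by_contra hne
  exact disjoint_left.1 (hI hne) (mem_filter.1 hj).2 (mem_filter.1 hj').2

theorem sum_success_le_one (D : Fin k → PMF (Fin n)) (hI : Pairwise (Disjoint on I))
    (t : SampleTree k n) : ∑ j, t.success D (I j) ≤ 1 := by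
  induction t with
  | output i => simpa only [success_output] using sum_indicator_le_one hI i
  | query i next ih =>
    simp only [success_query]
    rw [sum_comm]
    simpa only [← mul_sum] using sum_toReal_mul_le _ ih

theorem sum_expQueries_le_depth (D : Fin k → PMF (Fin n)) (hI : Pairwise (Disjoint on I))
    (t : SampleTree k n) : ∑ j, t.expQueries D (I j) ≤ t.depth := by
  induction t with
  | output i => simp [expQueries, depth]
  | query i next ih =>
    simp only [expQueries, depth, sum_add_distrib]
    rw [sum_comm]
    simp only [← mul_sum]
    push_cast
    refine add_le_add (sum_indicator_le_one hI i) (sum_toReal_mul_le _ fun x => (ih x).trans ?_)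
    exact_mod_cast le_sup (f := fun x => (next x).depth) (mem_univ x)

end Disjoint

section TapeTest

variable (I : Finset (Fin k))

/-- The test obtained by running the tree on two prerecorded tapes: queries to indices in `I` read
the first tape, all others read the second one. The test accepts when the output lies in `I`, and
also as soon as a tape is exhausted. -/
noncomputable def tapeTest :
    SampleTree k n → (m T : ℕ) → (Fin m → Fin n) → (Fin T → Fin n) → ℝ
  | .output i, _, _, _, _ => if i ∈ I then 1 else 0
  | .query i next, m, T, xs, ys =>
    if i ∈ I then
      match m, xs with
      | 0, _ => 1
      | m + 1, xs => tapeTest (next (xs 0)) m T (Fin.tail xs) ys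
    else
      match T, ys with
      | 0, _ => 1
      | T + 1, ys => tapeTest (next (ys 0)) m T xs (Fin.tail ys)

variable {I}

theorem tapeTest_mem_Icc (t : SampleTree k n) {m T : ℕ} (xs : Fin m → Fin n) (ys : Fin T → Fin n) :
    t.tapeTest I m T xs ys ∈ Set.Icc 0 1 := by
  induction t generalizing m T with
  | output i =>
    unfold tapeTest
    split_ifs <;> simp
  | query i next ih =>
    unfold tapeTest
    split_ifs
    · cases m with
      | zero => simp
      | succ m => exact ih _ _ _
    · cases T with
      | zero => simp
      | succ T => exact ih _ _ _

variable {i : Fin k} (next : Fin n → SampleTree k n) {p q : Fin n → ℝ} (m T : ℕ)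

theorem twoTapeSum_tapeTest_output (hp : ∑ x, p x = 1) (hq : ∑ x, q x = 1) :
    twoTapeSum p m q T ((output i).tapeTest I m T) = if i ∈ I then 1 else 0 :=
  twoTapeSum_const hp hq m T _

theorem twoTapeSum_tapeTest_of_mem_zero (hi : i ∈ I) (hp : ∑ x, p x = 1) (hq : ∑ x, q x = 1) :
    twoTapeSum p 0 q T ((query i next).tapeTest I 0 T) = 1 := by
  simp only [twoTapeSum, tapeTest.eq_def I (query i next), if_pos hi, iidSum_const hp,
    iidSum_const hq]

theorem twoTapeSum_tapeTest_of_mem_succ (hi : i ∈ I) :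
    twoTapeSum p (m + 1) q T ((query i next).tapeTest I (m + 1) T) =
      ∑ x, p x * twoTapeSum p m q T ((next x).tapeTest I m T) := by
  simp only [twoTapeSum_succ_left, tapeTest.eq_def I (query i next), if_pos hi, Fin.cons_zero,
    Fin.tail_cons]

theorem twoTapeSum_tapeTest_of_notMem_zero (hi : i ∉ I) (hp : ∑ x, p x = 1) (hq : ∑ x, q x = 1) :
    twoTapeSum p m q 0 ((query i next).tapeTest I m 0) = 1 := by
  simp only [twoTapeSum, tapeTest.eq_def I (query i next), if_neg hi, iidSum_const hp,
    iidSum_const hq]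

theorem twoTapeSum_tapeTest_of_notMem_succ (hi : i ∉ I) :
    twoTapeSum p m q (T + 1) ((query i next).tapeTest I m (T + 1)) =
      ∑ y, q y * twoTapeSum p m q T ((next y).tapeTest I m T) := by
  simp only [twoTapeSum_succ_right, tapeTest.eq_def I (query i next), if_neg hi, Fin.cons_zero,
    Fin.tail_cons]

theorem success_le_twoTapeSum_tapeTest (P Q : PMF (Fin n)) (t : SampleTree k n) :
    t.success (clusterInstance I P Q) I ≤
      twoTapeSum (fun x => (P x).toReal) m (fun x => (Q x).toReal) T (t.tapeTest I m T) := by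
  induction t generalizing m T with
  | output i =>
    rw [success_output,
      twoTapeSum_tapeTest_output m T (sum_toReal_eq_one P) (sum_toReal_eq_one Q)]
  | query i next ih =>
    by_cases hi : i ∈ I
    · cases m with
      | zero =>
        rw [twoTapeSum_tapeTest_of_mem_zero next T hi (sum_toReal_eq_one P) (sum_toReal_eq_one Q)]
        exact success_le_one _ _ _
      | succ m =>
        rw [success_query, twoTapeSum_tapeTest_of_mem_succ next m T hi]
        simp only [clusterInstance, if_pos hi]
        gcongr with x
        exact ih x m T
    · cases T with
      | zero =>
        rw [twoTapeSum_tapeTest_of_notMem_zero next m hi (sum_toReal_eq_one P)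
          (sum_toReal_eq_one Q)]
        exact success_le_one _ _ _
      | succ T =>
        rw [success_query, twoTapeSum_tapeTest_of_notMem_succ next m T hi]
        simp only [clusterInstance, if_neg hi]
        gcongr with y
        exact ih y m T

-- The first tape, of length `M` at the start, has been read `M - m` times: each reading of it is
-- charged `1 / (M + 1)`, so that exhausting it costs at least one.
theorem mul_twoTapeSum_tapeTest_le (Q : PMF (Fin n)) (t : SampleTree k n) {M : ℝ} (hm : m ≤ M)
    (hT : t.depth ≤ T) :
    (M + 1) * twoTapeSum (fun x => (Q x).toReal) m (fun x => (Q x).toReal) T (t.tapeTest I m T) ≤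
      (M + 1) * t.success (fun _ => Q) I + t.expQueries (fun _ => Q) I + (M - m) := by
  have hQ := sum_toReal_eq_one Q
  induction t generalizing m T with
  | output i =>
    rw [success_output, twoTapeSum_tapeTest_output m T hQ hQ, expQueries]
    linarith
  | query i next ih =>
    have hdepth (x : Fin n) : (next x).depth + 1 ≤ T := (depth_next_lt i next x).trans_le hT
    have hM : (0 : ℝ) ≤ M + 1 := by linarith [m.cast_nonneg (α := ℝ)]
    simp only [success_query, expQueries]
    by_cases hi : i ∈ I
    · simp only [if_pos hi]
      cases m with
      | zero =>
        rw [twoTapeSum_tapeTest_of_mem_zero next T hi hQ hQ]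
        have hS := mul_nonneg hM (success_nonneg (fun _ => Q) I (query i next))
        have hE := sum_nonneg fun x (_ : x ∈ univ) => mul_nonneg
          (ENNReal.toReal_nonneg (a := Q x)) (expQueries_nonneg (fun _ => Q) I (next x))
        rw [success_query] at hS
        push_cast
        linarith
      | succ m =>
        rw [twoTapeSum_tapeTest_of_mem_succ next m T hi]
        have := mul_sum_toReal_mul_le Q fun x => ih x m T (by push_cast at hm; linarith)
          (by have := hdepth x; omega)
        push_cast
        linarith
    · simp only [if_neg hi]
      cases T with
      | zero => exact absurd hT (by simp [depth])
      | succ T =>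
        rw [twoTapeSum_tapeTest_of_notMem_succ next m T hi]
        have := mul_sum_toReal_mul_le Q fun x => ih x m T hm (by have := hdepth x; omega)
        linarith

variable {T} in
theorem mul_sum_twoTapeSum_tapeTest_le {ι : Type*} [Fintype ι] {I : ι → Finset (Fin k)}
    (hI : Pairwise (Disjoint on I)) (Q : PMF (Fin n)) {t : SampleTree k n} (hT : t.depth ≤ T) :
    (m + 1) * ∑ j, twoTapeSum (fun x => (Q x).toReal) m (fun x => (Q x).toReal) T
      (t.tapeTest (I j) m T) ≤ (m + 1) + T := by
  have hsum := sum_le_sum fun j (_ : j ∈ univ) =>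
    mul_twoTapeSum_tapeTest_le m T (I := I j) Q t (le_refl (m : ℝ)) hT
  simp only [sub_self, add_zero, sum_add_distrib, ← mul_sum] at hsum
  have hsuccess := sum_success_le_one (fun _ => Q) hI t
  have hqueries := (sum_expQueries_le_depth (fun _ => Q) hI t).trans (Nat.cast_le.2 hT)
  nlinarith

end TapeTest

end SampleTree

theorem exists_disjoint_clusters {k q r : ℕ} (h : q * r ≤ k) :
    ∃ I : Fin q → Finset (Fin k), (∀ j, (I j).card = r) ∧ Pairwise (Disjoint on I) := by
  let e : Fin q × Fin r ↪ Fin k := finProdFinEquiv.toEmbedding.trans (Fin.castLEEmb h)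
  refine ⟨fun j => univ.map ((Embedding.sectR j (Fin r)).trans e), fun j => by simp,
    fun j j' hne => disjoint_left.2 fun i hi hi' => hne ?_⟩
  obtain ⟨s, -, hs⟩ := mem_map.1 hi
  obtain ⟨s', -, hs'⟩ := mem_map.1 hi'
  exact congrArg Prod.fst (e.injective (hs.trans hs'.symm))

namespace RandomizedAlgorithm

variable {k n : ℕ}

theorem exists_tree_le_expect_success (A : RandomizedAlgorithm k n) {ι : Type*} [Fintype ι]
    [Nonempty ι] (I : ι → Finset (Fin k)) (P Q : ι → PMF (Fin n))
    (h : ∀ a, A.FindsIndex (I a) (P a) (Q a)) :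
    ∃ t ∈ A.support, (9 / 10 : ℝ) ≤
      𝔼 a, t.success (clusterInstance (I a) (P a) (Q a)) (I a) := by
  set F : SampleTree k n → ENNReal := fun t =>
    ∑ a, ∑ i ∈ I a, t.run (clusterInstance (I a) (P a) (Q a)) i with hF
  have hfin (p : ι → PMF (Fin k)) (a : ι) : ∑ i ∈ I a, p a i ≠ ⊤ :=
    ENNReal.sum_ne_top.2 fun i _ => (p a).apply_ne_top i
  have hreal (p : ι → PMF (Fin k)) :
      (∑ a, ∑ i ∈ I a, p a i).toReal = ∑ a, ∑ i ∈ I a, (p a i).toReal := by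
    rw [ENNReal.toReal_sum fun a _ => hfin p a]
    exact sum_congr rfl fun a _ => ENNReal.toReal_sum fun i _ => (p a).apply_ne_top i
  have hF_avg : ∑' t, A t * F t = ∑ a, ∑ i ∈ I a, A.run (clusterInstance (I a) (P a) (Q a)) i := by
    simp only [hF, mul_sum]
    rw [Summable.tsum_finsetSum fun _ _ => ENNReal.summable]
    exact sum_congr rfl fun a _ => Summable.tsum_finsetSum fun _ _ => ENNReal.summable
  obtain ⟨t, ht, hle⟩ := exists_mem_support_le_of_le_tsum A (f := F)
    (c := ENNReal.ofReal (9 / 10 * Fintype.card ι)) ENNReal.ofReal_ne_top <| by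
      rw [hF_avg]
      refine ENNReal.ofReal_le_of_le_toReal ?_
      rw [hreal]
      simpa [mul_comm] using sum_le_sum fun a (_ : a ∈ univ) => h a
  refine ⟨t, ht, ?_⟩
  let p (a : ι) : PMF (Fin k) := t.run (clusterInstance (I a) (P a) (Q a))
  rw [ENNReal.ofReal_le_iff_le_toReal (ENNReal.sum_ne_top.2 fun a _ => hfin p a), hreal p] at hle
  rwa [Fintype.expect_eq_sum_div_card, le_div_iff₀ (by exact_mod_cast Fintype.card_pos)]

-- When the two laws coincide, one of `q` disjoint clusters chosen at random is returned with
-- probability at most `1 / q` and queried at most `T / q` times on average.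
theorem exists_distinguishing_test {q r m T : ℕ} (A : RandomizedAlgorithm k n)
    (hA : A.UsesAtMost T) (hqr : q * r ≤ k) (hq : 60 ≤ q) (hm : 20 * T ≤ q * (m + 1))
    {Ω : Type*} [Fintype Ω] [Nonempty Ω] (P Q : Ω → PMF (Fin n))
    (hfind : ∀ (I : Finset (Fin k)) ω, I.card = r → A.FindsIndex I (P ω) (Q ω)) :
    ∃ G : (Fin m → Fin n) → (Fin T → Fin n) → ℝ, (∀ xs ys, G xs ys ∈ Set.Icc 0 1) ∧
      𝔼 ω, twoTapeSum (fun x => (Q ω x).toReal) m (fun x => (Q ω x).toReal) T G + 1 / 2 <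
        𝔼 ω, twoTapeSum (fun x => (P ω x).toReal) m (fun x => (Q ω x).toReal) T G := by
  obtain ⟨I, hIcard, hI⟩ := exists_disjoint_clusters hqr
  have : Nonempty (Fin q) := Fin.pos_iff_nonempty.1 (by omega)
  obtain ⟨t, ht, hsucc⟩ := A.exists_tree_le_expect_success (ι := Fin q × Ω) (fun a => I a.1)
    (fun a => P a.2) (fun a => Q a.2) fun a => hfind _ _ (hIcard _)
  set null : Fin q → Ω → ℝ := fun j ω =>
    twoTapeSum (fun x => (Q ω x).toReal) m (fun x => (Q ω x).toReal) T (t.tapeTest (I j) m T)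
  set alt : Fin q → Ω → ℝ := fun j ω =>
    twoTapeSum (fun x => (P ω x).toReal) m (fun x => (Q ω x).toReal) T (t.tapeTest (I j) m T)
  have halt : 9 / 10 ≤ 𝔼 j, 𝔼 ω, alt j ω := by
    rw [← univ_product_univ, expect_product] at hsucc
    exact hsucc.trans <| expect_le_expect fun j _ => expect_le_expect fun ω _ =>
      SampleTree.success_le_twoTapeSum_tapeTest m T (P ω) (Q ω) t
  have hnull (ω : Ω) : 𝔼 j, null j ω ≤ 1 / 15 := by
    rw [Fintype.expect_eq_sum_div_card, Fintype.card_fin, div_le_iff₀ (by positivity)]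
    have hsum := SampleTree.mul_sum_twoTapeSum_tapeTest_le m hI (Q ω) (hA t ht)
    have hq' : (60 : ℝ) ≤ q := by exact_mod_cast hq
    have hm' : (20 * T : ℝ) ≤ q * (m + 1) := by exact_mod_cast hm
    refine le_of_mul_le_mul_left (hsum.trans ?_) (by positivity : (0 : ℝ) < m + 1)
    nlinarith [m.cast_nonneg (α := ℝ)]
  obtain ⟨j, -, hj⟩ : ∃ j ∈ univ, 𝔼 ω, null j ω + 1 / 2 < 𝔼 ω, alt j ω := by
    refine exists_lt_of_expect_lt_expect ?_
    rw [expect_add_distrib, expect_const univ_nonempty, expect_comm]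
    linarith [expect_le univ_nonempty fun ω _ => hnull ω]
  exact ⟨t.tapeTest (I j) m T, t.tapeTest_mem_Icc, hj⟩

end RandomizedAlgorithm
/-! ### Second moments of likelihood ratios -/

section UniformAverage

variable {α ι β : Type*} [Fintype α] [Fintype ι] [Fintype β]

theorem iidSum_card_inv_mul (L : α → ℝ) (m : ℕ) (F : (Fin m → α) → ℝ) :
    iidSum (fun x => (Fintype.card α : ℝ)⁻¹ * L x) m F = 𝔼 xs, (∏ s, L (xs s)) * F xs := by
  rw [iidSum_mul_weight, iidSum, ← mul_sum, Fintype.expect_eq_sum_div_card]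
  simp [div_eq_inv_mul]

theorem iidSum_card_inv (m : ℕ) (F : (Fin m → α) → ℝ) :
    iidSum (fun _ => (Fintype.card α : ℝ)⁻¹) m F = 𝔼 xs, F xs := by
  simpa using iidSum_card_inv_mul (fun _ => 1) m F

theorem expect_prod_pi [DecidableEq ι] (f : ι → β → ℝ) :
    𝔼 z : ι → β, ∏ j, f j (z j) = ∏ j, 𝔼 p, f j p := by
  simp [Fintype.expect_eq_sum_div_card, prod_div_distrib, Finset.prod_univ_sum]

-- The difference to the mean `W` is integrated against `g` by `|X - W| ≤ (X - W) ^ 2 / W + W / 4`.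
theorem expect_mul_test_le {X g : α → ℝ} {W χ : ℝ} (hW : 0 < W) (hX : 𝔼 y, X y = W)
    (hX2 : 𝔼 y, X y ^ 2 ≤ (1 + χ) * W ^ 2) (hg : ∀ y, g y ∈ Set.Icc 0 1) :
    𝔼 y, X y * g y ≤ W * (𝔼 y, g y + χ + 1 / 4) := by
  have : Nonempty α := by
    by_contra h
    rw [not_nonempty_iff] at h
    exact hW.ne (by rw [← hX, univ_eq_empty, expect_empty])
  have hpt (y : α) : X y * g y ≤ W * g y + X y ^ 2 / W - 2 * X y + 5 / 4 * W := by
    have hdev : |X y - W| ≤ (X y - W) ^ 2 / W + W / 4 := by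
      rw [← sq_abs, ← sub_nonneg, show |X y - W| ^ 2 / W + W / 4 - |X y - W| =
        (|X y - W| - W / 2) ^ 2 / W by field_simp; ring]
      positivity
    have htest : (X y - W) * g y ≤ |X y - W| :=
      (mul_le_mul_of_nonneg_right (le_abs_self _) (hg y).1).trans
        (mul_le_of_le_one_right (abs_nonneg _) (hg y).2)
    have hsq : (X y - W) ^ 2 / W = X y ^ 2 / W - 2 * X y + W := by field_simp; ring
    linarith
  have havg := expect_le_expect fun y (_ : y ∈ univ) => hpt y
  have hX2' : (𝔼 y, X y ^ 2) / W ≤ (1 + χ) * W := by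
    rw [div_le_iff₀ hW]
    linarith
  simp only [expect_add_distrib, expect_sub_distrib, ← mul_expect, ← expect_div,
    Fintype.expect_const, hX] at havg
  linarith

theorem expect_iidSum_le_of_second_moment {Ω : Type*} [Fintype Ω] {L : Ω → α → ℝ} {m : ℕ} {χ : ℝ}
    [Nonempty Ω] (hL : ∀ ω, 𝔼 x, L ω x = 1)
    (hL2 : 𝔼 ω, 𝔼 ω', (𝔼 x, L ω x * L ω' x) ^ m ≤ 1 + χ)
    {G : (Fin m → α) → ℝ} (hG : ∀ xs, G xs ∈ Set.Icc 0 1) :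
    𝔼 ω, iidSum (fun x => (Fintype.card α : ℝ)⁻¹ * L ω x) m G ≤ 𝔼 xs, G xs + χ + 1 / 4 := by
  have hmean : 𝔼 xs : Fin m → α, 𝔼 ω, ∏ s, L ω (xs s) = 1 := by
    rw [expect_comm]
    simp [expect_prod_pi, hL]
  have hsq : 𝔼 xs : Fin m → α, (𝔼 ω, ∏ s, L ω (xs s)) ^ 2 ≤ (1 + χ) * 1 ^ 2 := by
    rw [one_pow, mul_one]
    refine le_of_eq_of_le ?_ hL2
    simp only [sq, expect_mul_expect, ← prod_mul_distrib]
    rw [expect_comm]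
    refine expect_congr rfl fun ω _ => ?_
    rw [expect_comm]
    refine expect_congr rfl fun ω' _ => ?_
    simp [expect_prod_pi fun (_ : Fin m) x => L ω x * L ω' x]
  simp only [iidSum_card_inv_mul]
  rw [expect_comm]
  simpa only [one_mul, expect_mul] using expect_mul_test_le one_pos hmean hsq hG

end UniformAverage

/-! ### Randomly placed peaks -/

section Peak

variable {β : Type*} [Fintype β] [DecidableEq β]

/-- The density, with respect to the uniform law on `β`, of the point mass at `p₀`. -/
def peak (p₀ p : β) : ℝ :=
  if p = p₀ then Fintype.card β else 0

theorem peak_nonneg (p₀ p : β) : 0 ≤ peak p₀ p := by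
  unfold peak
  positivity

theorem peak_comm (p₀ p : β) : peak p₀ p = peak p p₀ :=
  if_congr eq_comm rfl rfl

theorem expect_peak_mul (p₀ : β) (f : β → ℝ) : 𝔼 p, peak p₀ p * f p = f p₀ := by
  have : Nonempty β := ⟨p₀⟩
  rw [Fintype.expect_eq_sum_div_card]
  simp [peak, ite_mul]

theorem expect_peak (p₀ : β) : 𝔼 p, peak p₀ p = 1 := by
  simpa using expect_peak_mul p₀ fun _ => 1

theorem expect_peak_mul_peak (p₀ p₁ : β) : 𝔼 p, peak p₀ p * peak p₁ p = peak p₁ p₀ :=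
  expect_peak_mul p₀ _

theorem peak_self (p₀ : β) : peak p₀ p₀ = Fintype.card β :=
  if_pos rfl

theorem expect_abs_peak_sub_one (p₀ : β) :
    𝔼 p, |peak p₀ p - 1| = 2 * (1 - 1 / Fintype.card β) := by
  have : Nonempty β := ⟨p₀⟩
  have hb : (1 : ℝ) ≤ Fintype.card β := by exact_mod_cast Fintype.card_pos
  have hpt (p : β) : |peak p₀ p - 1| = 1 + (1 - 2 / Fintype.card β) * peak p₀ p := by
    unfold peak
    split_ifs
    · rw [abs_of_nonneg (by linarith)]
      field_simp
      ring
    · simp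
  simp only [hpt, expect_add_distrib, ← mul_expect, expect_peak, Fintype.expect_const]
  ring

theorem expect_exp_mul_peak_sub_one_le {t : ℝ} (ht : 0 ≤ t) (p₀ : β)
    (htb : t * Fintype.card β ≤ 1) :
    𝔼 p, Real.exp (t * (peak p₀ p - 1)) ≤ Real.exp (t ^ 2 * Fintype.card β) := by
  have : Nonempty β := ⟨p₀⟩
  have hb : (1 : ℝ) ≤ Fintype.card β := by exact_mod_cast Fintype.card_pos
  have hpt (p : β) : Real.exp (t * (peak p₀ p - 1)) ≤
      1 + t * (peak p₀ p - 1) + t ^ 2 * (peak p₀ p * peak p₀ p - 2 * peak p₀ p + 1) := by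
    have habs : |t * (peak p₀ p - 1)| ≤ 1 := by
      rw [abs_le]
      unfold peak
      split_ifs <;> constructor <;> nlinarith
    linarith [(abs_le.1 (Real.abs_exp_sub_one_sub_id_le habs)).2]
  refine (expect_le_expect fun p _ => hpt p).trans ?_
  simp only [expect_add_distrib, expect_sub_distrib, ← mul_expect, Fintype.expect_const,
    expect_peak, expect_peak_mul_peak, peak_self]
  nlinarith [Real.add_one_le_exp (t ^ 2 * Fintype.card β), sq_nonneg t]

end Peak

theorem exp_le_five_fourths {x : ℝ} (hx : x ≤ 1 / 5) : Real.exp x ≤ 5 / 4 :=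
  calc Real.exp x ≤ Real.exp (1 / 5) := by gcongr
    _ ≤ 1 / (1 - 1 / 5) := Real.exp_bound_div_one_sub_of_interval (by norm_num) (by norm_num)
    _ = 5 / 4 := by norm_num

section Bump

variable {ι β γ : Type*} [Fintype β] [DecidableEq β]

/-- The density, with respect to the uniform law on the blocks `{j} × β` and the leftover set `γ`,
of the law that moves a fraction `a` of the mass of each block `j` to its point `z j`. -/
def bumpRatio (a : ℝ) (z : ι → β) : (ι × β) ⊕ γ → ℝ
  | .inl (j, p) => 1 + a * (peak (z j) p - 1)
  | .inr _ => 1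

theorem bumpRatio_nonneg {a : ℝ} (ha0 : 0 ≤ a) (ha1 : a ≤ 1) (z : ι → β) (s : (ι × β) ⊕ γ) :
    0 ≤ bumpRatio a z s := by
  rcases s with ⟨j, p⟩ | _
  · have := mul_nonneg ha0 (peak_nonneg (z j) p)
    simp only [bumpRatio]
    linarith
  · exact zero_le_one

variable [Fintype ι] [Fintype γ] [Nonempty β]

omit [DecidableEq β] in
theorem expect_blocks {f : (ι × β) ⊕ γ → ℝ} (hf : ∀ x, f (.inr x) = 0) :
    𝔼 s, f s =
      Fintype.card β / Fintype.card ((ι × β) ⊕ γ) * ∑ j, 𝔼 p, f (.inl (j, p)) := by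
  simp only [Fintype.expect_eq_sum_div_card, Fintype.sum_sum_type, Fintype.sum_prod_type, hf,
    sum_const_zero, add_zero, ← sum_div]
  field_simp

variable [Nonempty ι]

theorem expect_bumpRatio (a : ℝ) (z : ι → β) : 𝔼 s : (ι × β) ⊕ γ, bumpRatio a z s = 1 := by
  have h : 𝔼 s : (ι × β) ⊕ γ, (bumpRatio a z s - 1) = 0 := by
    rw [expect_blocks fun _ => sub_self 1]
    simp only [bumpRatio, add_sub_cancel_left, ← mul_expect, expect_sub_distrib, expect_peak,
      Fintype.expect_const, sub_self, mul_zero, sum_const_zero]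
  rwa [expect_sub_distrib, Fintype.expect_const, sub_eq_zero] at h

theorem expect_bumpRatio_mul_bumpRatio (a : ℝ) (z z' : ι → β) :
    𝔼 s : (ι × β) ⊕ γ, bumpRatio a z s * bumpRatio a z' s =
      1 + a ^ 2 * Fintype.card β / Fintype.card ((ι × β) ⊕ γ) *
        ∑ j, (peak (z j) (z' j) - 1) := by
  have hblock (j : ι) : 𝔼 p, ((1 + a * (peak (z j) p - 1)) * (1 + a * (peak (z' j) p - 1)) - 1) =
      a ^ 2 * (peak (z j) (z' j) - 1) := by
    have hpt (p : β) : (1 + a * (peak (z j) p - 1)) * (1 + a * (peak (z' j) p - 1)) - 1 =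
        (a - a ^ 2) * (peak (z j) p - 1) + (a - a ^ 2) * (peak (z' j) p - 1) +
          a ^ 2 * (peak (z' j) p * peak (z j) p - 1) := by ring
    simp only [hpt, expect_add_distrib, expect_sub_distrib, ← mul_expect, expect_peak,
      expect_peak_mul_peak, Fintype.expect_const]
    ring
  have h : 𝔼 s : (ι × β) ⊕ γ, (bumpRatio a z s * bumpRatio a z' s - 1) =
      a ^ 2 * Fintype.card β / Fintype.card ((ι × β) ⊕ γ) * ∑ j, (peak (z j) (z' j) - 1) := by
    rw [expect_blocks fun _ => by simp only [bumpRatio]; ring]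
    simp only [bumpRatio, hblock, ← mul_sum]
    ring
  rw [expect_sub_distrib, Fintype.expect_const] at h
  linarith

omit [Nonempty ι] in
theorem expect_abs_bumpRatio_sub_one {a : ℝ} (ha : 0 ≤ a) (z : ι → β) :
    𝔼 s : (ι × β) ⊕ γ, |bumpRatio a z s - 1| =
      2 * (a * Fintype.card ι * (Fintype.card β - 1)) / Fintype.card ((ι × β) ⊕ γ) := by
  have hpt (j : ι) (p : β) : |1 + a * (peak (z j) p - 1) - 1| = a * |peak (z j) p - 1| := by
    rw [add_sub_cancel_left, abs_mul, abs_of_nonneg ha]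
  rw [expect_blocks fun _ => by simp [bumpRatio]]
  simp only [bumpRatio, hpt, ← mul_expect, expect_abs_peak_sub_one, sum_const, card_univ,
    nsmul_eq_mul]
  field_simp

-- With `t = m a² b / n`, the `m`-th power of the correlation of two random bumps is at most
-- `exp (t ∑ⱼ (peak (z j) (z' j) - 1))`, an exponential of independent centred variables.
theorem expect_correlation_pow_le [DecidableEq ι] {a : ℝ} (ha0 : 0 ≤ a) (ha1 : a ≤ 1) {m : ℕ}
    {t : ℝ}
    (ht : t = m * a ^ 2 * Fintype.card β / Fintype.card ((ι × β) ⊕ γ))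
    (htb : t * Fintype.card β ≤ 1) (htn : t ^ 2 * Fintype.card ((ι × β) ⊕ γ) ≤ 1 / 5)
    (z : ι → β) :
    𝔼 z' : ι → β, (𝔼 s : (ι × β) ⊕ γ, bumpRatio a z s * bumpRatio a z' s) ^ m ≤ 1 + 1 / 4 := by
  have hpow (z' : ι → β) : (𝔼 s : (ι × β) ⊕ γ, bumpRatio a z s * bumpRatio a z' s) ^ m ≤
      ∏ j, Real.exp (t * (peak (z j) (z' j) - 1)) := by
    have h0 : 0 ≤ 𝔼 s : (ι × β) ⊕ γ, bumpRatio a z s * bumpRatio a z' s :=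
      expect_nonneg fun s _ =>
        mul_nonneg (bumpRatio_nonneg ha0 ha1 z s) (bumpRatio_nonneg ha0 ha1 z' s)
    rw [expect_bumpRatio_mul_bumpRatio, add_comm] at h0 ⊢
    refine (pow_le_pow_left₀ h0 (Real.add_one_le_exp _) m).trans_eq ?_
    rw [← Real.exp_nat_mul, ← Real.exp_sum, ← mul_sum, ht]
    ring_nf
  have ht0 : 0 ≤ t := by rw [ht]; positivity
  have hsize : (Fintype.card β * Fintype.card ι : ℝ) ≤ Fintype.card ((ι × β) ⊕ γ) := by
    simp [mul_comm]
  calc 𝔼 z' : ι → β, (𝔼 s : (ι × β) ⊕ γ, bumpRatio a z s * bumpRatio a z' s) ^ m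
      ≤ 𝔼 z' : ι → β, ∏ j, Real.exp (t * (peak (z j) (z' j) - 1)) :=
        expect_le_expect fun z' _ => hpow z'
    _ = ∏ j, 𝔼 p, Real.exp (t * (peak (z j) p - 1)) :=
        expect_prod_pi fun j p => Real.exp (t * (peak (z j) p - 1))
    _ ≤ ∏ _j : ι, Real.exp (t ^ 2 * Fintype.card β) :=
        prod_le_prod (fun j _ => expect_nonneg fun p _ => (Real.exp_pos _).le)
          fun j _ => expect_exp_mul_peak_sub_one_le ht0 (z j) htb
    _ = Real.exp (t ^ 2 * (Fintype.card β * Fintype.card ι)) := by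
        rw [prod_const, card_univ, ← Real.exp_nat_mul]
        ring_nf
    _ ≤ 5 / 4 :=
        exp_le_five_fourths ((mul_le_mul_of_nonneg_left hsize (sq_nonneg t)).trans htn)
    _ = 1 + 1 / 4 := by norm_num

end Bump

theorem tvDist_eq_expect {n : ℕ} [NeZero n] {P : PMF (Fin n)} {L : Fin n → ℝ}
    (hP : ∀ x, (P x).toReal = (n : ℝ)⁻¹ * L x) :
    tvDist P (PMF.uniformOfFintype (Fin n)) = (1 / 2) * 𝔼 x, |L x - 1| := by
  have h (x : Fin n) : |(n : ℝ)⁻¹ * L x - (n : ℝ)⁻¹| = (n : ℝ)⁻¹ * |L x - 1| := by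
    rw [← mul_sub_one, abs_mul, abs_of_nonneg (by positivity)]
  simp only [tvDist, hP, PMF.uniformOfFintype_apply, ENNReal.toReal_inv, ENNReal.toReal_natCast,
    Fintype.card_fin, h, ← mul_sum, Fintype.expect_eq_sum_div_card]
  ring

theorem RandomizedAlgorithm.not_solvesOneKnown_of_blocks {n k q r m T : ℕ} [NeZero n]
    {A : RandomizedAlgorithm k n} (hA : A.UsesAtMost T) (hqr : q * r ≤ k) (hq : 60 ≤ q)
    (hm : 20 * T ≤ q * (m + 1)) {h b : ℕ} [NeZero h] [NeZero b] (hhb : h * b ≤ n)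
    {ε a t : ℝ} (ha0 : 0 ≤ a) (ha1 : a ≤ 1) (hε : ε ≤ a * h * (b - 1) / n)
    (ht : t = m * a ^ 2 * b / n) (htb : t * b ≤ 1) (htn : t ^ 2 * n ≤ 1 / 5) :
    ¬ A.SolvesOneKnown r ε := by
  intro hsol
  have hcard : Fintype.card ((Fin h × Fin b) ⊕ Fin (n - h * b)) = n := by
    simp [Nat.add_sub_cancel' hhb]
  let e : Fin n ≃ (Fin h × Fin b) ⊕ Fin (n - h * b) := (Fintype.equivFinOfCardEq hcard).symm
  set L : (Fin h → Fin b) → Fin n → ℝ := fun z x => bumpRatio a z (e x)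
  have hL_expect (F : (Fin h × Fin b) ⊕ Fin (n - h * b) → ℝ) : 𝔼 x, F (e x) = 𝔼 s, F s :=
    Fintype.expect_equiv e _ _ fun _ => rfl
  have hL (z : Fin h → Fin b) : 𝔼 x, L z x = 1 := by
    rw [hL_expect (bumpRatio a z), expect_bumpRatio]
  have hsum (z : Fin h → Fin b) : ∑ x, (n : ℝ)⁻¹ * L z x = 1 := by
    rw [← hL z, Fintype.expect_eq_sum_div_card, Fintype.card_fin, ← mul_sum, inv_mul_eq_div]
  choose P hP using fun z => exists_pmf_toReal_eq
    (fun x => mul_nonneg (by positivity) (bumpRatio_nonneg ha0 ha1 z (e x))) (hsum z)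
  obtain ⟨G, hG, hlt⟩ := A.exists_distinguishing_test hA hqr hq hm P
    (fun _ => PMF.uniformOfFintype (Fin n)) fun I z hI => hsol I (P z) hI <| by
      rw [tvDist_eq_expect (hP z), hL_expect fun s => |bumpRatio a z s - 1|,
        expect_abs_bumpRatio_sub_one ha0, hcard, Fintype.card_fin, Fintype.card_fin]
      exact hε.trans_eq (by ring)
  have hsecond : 𝔼 z, 𝔼 z', (𝔼 x, L z x * L z' x) ^ m ≤ 1 + (1 / 4 : ℝ) := by
    refine expect_le univ_nonempty fun z _ => ?_
    refine le_of_eq_of_le (expect_congr rfl fun z' _ => congrArg (· ^ m) <|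
      hL_expect fun s => bumpRatio a z s * bumpRatio a z' s) ?_
    exact expect_correlation_pow_le (t := t) ha0 ha1 (by rw [hcard, Fintype.card_fin, ht])
      (by rwa [Fintype.card_fin]) (by rwa [hcard]) z
  refine hlt.not_ge ?_
  have hle := expect_iidSum_le_of_second_moment hL hsecond
    (G := fun xs => 𝔼 ys : Fin T → Fin n, G xs ys) fun xs =>
      ⟨expect_nonneg fun ys _ => (hG xs ys).1, expect_le univ_nonempty fun ys _ => (hG xs ys).2⟩
  have hunif (x : Fin n) : (PMF.uniformOfFintype (Fin n) x).toReal = (n : ℝ)⁻¹ := by simp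
  have htape := iidSum_card_inv (α := Fin n)
  simp only [Fintype.card_fin] at hle htape
  simp only [hP, hunif, twoTapeSum, htape, Fintype.expect_const]
  linarith
/-! ### Posterior of a random set of heavy blocks -/

section HeavySets

variable {ι : Type*} [DecidableEq ι]

/-- The mass of block `j` when the blocks in `θ` are heavy, with mass `η`, and the others light,
with mass `lam`. -/
def blockMass (η lam : ℝ) (θ : Finset ι) (j : ι) : ℝ :=
  if j ∈ θ then η else lam

variable {η lam : ℝ}

theorem blockMass_pos (hη : 0 < η) (hlam : 0 < lam) (θ : Finset ι) (j : ι) :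
    0 < blockMass η lam θ j := by
  unfold blockMass
  positivity

theorem blockMass_le (hle : lam ≤ η) (θ : Finset ι) (j : ι) : blockMass η lam θ j ≤ η := by
  unfold blockMass
  split_ifs <;> simp [hle]

variable [Fintype ι]

theorem sum_blockMass (η lam : ℝ) (θ : Finset ι) :
    ∑ j, blockMass η lam θ j = #θ * η + (Fintype.card ι - #θ) * lam := by
  have h (j : ι) : blockMass η lam θ j = lam + if j ∈ θ then η - lam else 0 := by
    unfold blockMass
    split_ifs <;> ring
  simp only [h, sum_add_distrib, sum_ite_mem, univ_inter, sum_const, card_univ, nsmul_eq_mul]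
  ring

/-- The likelihood of the set `θ` of heavy blocks when block `j` has been observed `c j` times. -/
def blockLikelihood (η lam : ℝ) (c : ι → ℕ) (θ : Finset ι) : ℝ :=
  ∏ j, blockMass η lam θ j ^ c j

theorem blockLikelihood_pos (hη : 0 < η) (hlam : 0 < lam) (c : ι → ℕ) (θ : Finset ι) :
    0 < blockLikelihood η lam c θ :=
  prod_pos fun j _ => pow_pos (blockMass_pos hη hlam θ j) _

theorem blockLikelihood_eq_mul_insert_erase (hη : 0 < η) {c : ι → ℕ} {θ : Finset ι} {j h : ι}
    (hj : j ∉ θ) (hh : h ∈ θ) (hc : c h = 0) :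
    blockLikelihood η lam c θ =
      (lam / η) ^ c j * blockLikelihood η lam c (insert j (θ.erase h)) := by
  have hfactor (i : ι) : blockMass η lam θ i ^ c i = (if i = j then (lam / η) ^ c j else 1) *
      blockMass η lam (insert j (θ.erase h)) i ^ c i := by
    rcases eq_or_ne i j with rfl | hij
    · simp [blockMass, hj, ← mul_pow, div_mul_cancel₀ _ hη.ne']
    · rcases eq_or_ne i h with rfl | hih
      · simp [hij, hc]
      · simp [blockMass, hij, hih]
  simp only [blockLikelihood, hfactor, prod_mul_distrib, prod_ite_eq', mem_univ, if_true]

variable {c : ι → ℕ} {K : ℕ} {A : Finset ι} {j : ι}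

-- Exchanging the light block `j` with the unseen heavy block `h` is injective.
theorem sum_blockLikelihood_mem_le (hη : 0 < η) (hlam : 0 < lam) (hj : j ∉ A) {h : ι}
    (hc : c h = 0) :
    ∑ θ ∈ powersetCard K univ with Disjoint (insert j A) θ ∧ h ∈ θ, blockLikelihood η lam c θ ≤
      (lam / η) ^ c j *
        ∑ θ ∈ powersetCard K univ with Disjoint A θ, blockLikelihood η lam c θ := by
  set S := {θ ∈ powersetCard K (univ : Finset ι) | Disjoint (insert j A) θ ∧ h ∈ θ}
  have hS {θ : Finset ι} (hθ : θ ∈ S) : #θ = K ∧ j ∉ θ ∧ Disjoint A θ ∧ h ∈ θ := by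
    simpa [S, and_assoc] using hθ
  have hinj : Set.InjOn (fun θ : Finset ι => insert j (θ.erase h)) S := by
    refine Set.LeftInvOn.injOn (f₁' := fun θ => insert h (θ.erase j)) fun θ hθ => ?_
    obtain ⟨-, hjθ, -, hhθ⟩ := hS hθ
    dsimp only
    rw [erase_insert fun hmem => hjθ (mem_of_mem_erase hmem), insert_erase hhθ]
  rw [mul_sum]
  calc ∑ θ ∈ S, blockLikelihood η lam c θ
      = ∑ θ ∈ S, (lam / η) ^ c j * blockLikelihood η lam c (insert j (θ.erase h)) :=
        sum_congr rfl fun θ hθ =>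
          blockLikelihood_eq_mul_insert_erase hη (hS hθ).2.1 (hS hθ).2.2.2 hc
    _ = ∑ θ ∈ S.image fun θ => insert j (θ.erase h), (lam / η) ^ c j * blockLikelihood η lam c θ :=
        (sum_image (f := fun θ => (lam / η) ^ c j * blockLikelihood η lam c θ) hinj).symm
    _ ≤ _ := by
      refine sum_le_sum_of_subset_of_nonneg (image_subset_iff.2 fun θ hθ => ?_) fun θ _ _ =>
        mul_nonneg (by positivity) (blockLikelihood_pos hη hlam c θ).le
      obtain ⟨hcard, hjθ, hAθ, hhθ⟩ := hS hθ
      rw [mem_filter, mem_powersetCard_univ, disjoint_insert_right, card_insert_of_notMem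
        fun hmem => hjθ (mem_of_mem_erase hmem), card_erase_add_one hhθ]
      exact ⟨hcard, hj, hAθ.mono_right (erase_subset h θ)⟩

omit [DecidableEq ι] in
theorem le_two_mul_card_unseen (hK : 2 * #{j | c j ≠ 0} ≤ K) {θ : Finset ι} (hθ : #θ = K) :
    K ≤ 2 * #{h ∈ θ | c h = 0} := by
  have hsplit := card_filter_add_card_filter_not (s := θ) fun h => c h = 0
  have hseen : #{h ∈ θ | ¬c h = 0} ≤ #{j | c j ≠ 0} :=
    card_le_card (filter_subset_filter _ (subset_univ θ))
  omega

theorem sum_blockLikelihood_insert_le (hη : 0 < η) (hlam : 0 < lam)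
    (hK : 2 * #{j | c j ≠ 0} ≤ K) (hK0 : 0 < K) (hj : j ∉ A) :
    ∑ θ ∈ powersetCard K univ with Disjoint (insert j A) θ, blockLikelihood η lam c θ ≤
      ((lam / η) ^ c j * (2 * Fintype.card ι / K)) *
        ∑ θ ∈ powersetCard K univ with Disjoint A θ, blockLikelihood η lam c θ := by
  set S := ∑ θ ∈ powersetCard K univ with Disjoint A θ, blockLikelihood η lam c θ
  have hL (θ : Finset ι) := (blockLikelihood_pos hη hlam c θ).le
  have hK0' : (0 : ℝ) < K := by exact_mod_cast hK0
  have hcount : K * ∑ θ ∈ powersetCard K univ with Disjoint (insert j A) θ,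
      blockLikelihood η lam c θ ≤ 2 * (Fintype.card ι * ((lam / η) ^ c j * S)) := by
    calc K * ∑ θ ∈ powersetCard K univ with Disjoint (insert j A) θ, blockLikelihood η lam c θ
        ≤ ∑ θ ∈ powersetCard K univ with Disjoint (insert j A) θ,
            2 * ∑ _h ∈ θ with c _h = 0, blockLikelihood η lam c θ := by
          rw [mul_sum]
          refine sum_le_sum fun θ hθ => ?_
          rw [sum_const, nsmul_eq_mul, ← mul_assoc]
          refine mul_le_mul_of_nonneg_right ?_ (hL θ)
          exact_mod_cast le_two_mul_card_unseen hK
            (mem_powersetCard_univ.1 (mem_filter.1 hθ).1)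
      _ = 2 * ∑ h with c h = 0, ∑ θ ∈ powersetCard K univ with
            Disjoint (insert j A) θ ∧ h ∈ θ, blockLikelihood η lam c θ := by
          rw [← mul_sum]
          congr 1
          refine sum_comm' fun θ h => ?_
          simp only [mem_filter, mem_univ, true_and]
          tauto
      _ ≤ 2 * ∑ h with c h = 0, (lam / η) ^ c j * S := by
          gcongr with h hh
          exact sum_blockLikelihood_mem_le hη hlam hj (mem_filter.1 hh).2
      _ ≤ 2 * (Fintype.card ι * ((lam / η) ^ c j * S)) := by
          have hS : 0 ≤ S := sum_nonneg fun θ _ => hL θ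
          rw [sum_const, nsmul_eq_mul]
          gcongr
          exact card_le_univ _
  refine le_of_mul_le_mul_left (hcount.trans_eq ?_) hK0'
  field_simp

theorem sum_blockLikelihood_disjoint_le (hη : 0 < η) (hlam : 0 < lam)
    (hK : 2 * #{j | c j ≠ 0} ≤ K) (hK0 : 0 < K) (A : Finset ι) :
    ∑ θ ∈ powersetCard K univ with Disjoint A θ, blockLikelihood η lam c θ ≤
      (∏ j ∈ A, (lam / η) ^ c j * (2 * Fintype.card ι / K)) *
        ∑ θ ∈ powersetCard K univ, blockLikelihood η lam c θ := by
  induction A using Finset.induction_on with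
  | empty => simp
  | insert j A hj ih =>
    rw [prod_insert hj, mul_assoc]
    exact (sum_blockLikelihood_insert_le hη hlam hK hK0 hj).trans
      (mul_le_mul_of_nonneg_left ih (by positivity))

theorem prod_ite_notMem_eq_sum (φ : ι → ℝ) (θ θ' : Finset ι) :
    ∏ j, (if j ∉ θ ∧ j ∉ θ' then φ j else 1) = ∑ A : Finset ι, (∏ j ∈ A, (φ j - 1)) *
      ((if Disjoint A θ then 1 else 0) * if Disjoint A θ' then 1 else 0) := by
  have h (j : ι) : (if j ∉ θ ∧ j ∉ θ' then φ j else 1) =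
      1 + if j ∉ θ ∧ j ∉ θ' then φ j - 1 else 0 := by split_ifs <;> ring
  simp only [h, prod_one_add, powerset_univ, prod_ite_zero, disjoint_left, forall_and,
    mul_ite, mul_one, mul_zero, ← ite_and]
  exact sum_congr rfl fun A _ => if_congr and_comm rfl rfl

theorem sum_sum_mul_prod_ite_notMem_le {F : Finset (Finset ι)} {w : Finset ι → ℝ} {d φ : ι → ℝ}
    (hw : ∀ θ, 0 ≤ w θ) (hφ : ∀ j, 1 ≤ φ j)
    (hd : ∀ A, ∑ θ ∈ F with Disjoint A θ, w θ ≤ (∏ j ∈ A, d j) * ∑ θ ∈ F, w θ) :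
    ∑ θ ∈ F, ∑ θ' ∈ F, w θ * w θ' * ∏ j, (if j ∉ θ ∧ j ∉ θ' then φ j else 1) ≤
      (∏ j, (1 + (φ j - 1) * d j ^ 2)) * (∑ θ ∈ F, w θ) ^ 2 := by
  calc ∑ θ ∈ F, ∑ θ' ∈ F, w θ * w θ' * ∏ j, (if j ∉ θ ∧ j ∉ θ' then φ j else 1)
      = ∑ A : Finset ι, (∏ j ∈ A, (φ j - 1)) * (∑ θ ∈ F with Disjoint A θ, w θ) ^ 2 := by
        simp only [prod_ite_notMem_eq_sum, mul_sum]
        rw [sum_congr rfl fun θ _ => sum_comm, sum_comm]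
        refine sum_congr rfl fun A _ => ?_
        rw [sum_filter, sq, sum_mul_sum, mul_sum]
        refine sum_congr rfl fun θ _ => ?_
        rw [mul_sum]
        refine sum_congr rfl fun θ' _ => ?_
        split_ifs <;> ring
    _ ≤ ∑ A : Finset ι, (∏ j ∈ A, (φ j - 1)) * ((∏ j ∈ A, d j) * ∑ θ ∈ F, w θ) ^ 2 := by
        gcongr with A
        · exact prod_nonneg fun j _ => sub_nonneg.2 (hφ j)
        · exact sum_nonneg fun θ _ => hw θ
        · exact hd A
    _ = (∏ j, (1 + (φ j - 1) * d j ^ 2)) * (∑ θ ∈ F, w θ) ^ 2 := by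
        simp only [prod_one_add, powerset_univ, sum_mul, prod_mul_distrib, prod_pow, mul_pow,
          mul_assoc]

end HeavySets
section Occurrences

variable {α : Type*} [DecidableEq α] {m : ℕ}

/-- The number of draws on the tape `u` with value `j`. -/
def occurrences (u : Fin m → α) (j : α) : ℕ :=
  #{s | u s = j}

theorem occurrences_cons (x : α) (u : Fin m → α) (j : α) :
    occurrences (Fin.cons x u : Fin (m + 1) → α) j =
      occurrences u j + if x = j then 1 else 0 := by
  simp only [occurrences, card_filter, Fin.sum_univ_succ, Fin.cons_zero, Fin.cons_succ, add_comm]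

variable [Fintype α]

theorem card_occurrences_ne_zero_le (u : Fin m → α) : #{j | occurrences u j ≠ 0} ≤ m := by
  have hsub : ({j | occurrences u j ≠ 0} : Finset α) ⊆ univ.image u := fun j hj => by
    obtain ⟨s, hs⟩ := card_ne_zero.1 (mem_filter.1 hj).2
    exact mem_image.2 ⟨s, mem_univ s, (mem_filter.1 hs).2⟩
  exact (card_le_card hsub).trans (card_image_le.trans_eq (card_fin m))

theorem prod_comp_eq_prod_pow_occurrences (f : α → ℝ) (u : Fin m → α) :
    ∏ s, f (u s) = ∏ j, f j ^ occurrences u j := by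
  rw [← prod_fiberwise' univ u f]
  simp only [prod_const, occurrences]

/-- The number of draws on the tape `u` that repeat an earlier value. Truncated subtraction makes
values that do not occur contribute `0`. -/
def repetitions (u : Fin m → α) : ℕ :=
  ∑ j, (occurrences u j - 1)

theorem repetitions_cons (x : α) (u : Fin m → α) :
    repetitions (Fin.cons x u : Fin (m + 1) → α) =
      repetitions u + if occurrences u x ≠ 0 then 1 else 0 := by
  have h (j : α) : occurrences (Fin.cons x u : Fin (m + 1) → α) j - 1 =
      occurrences u j - 1 + if x = j then if occurrences u x ≠ 0 then 1 else 0 else 0 := by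
    rw [occurrences_cons]
    split_ifs <;> subst_vars <;> omega
  simp only [repetitions, h, sum_add_distrib, sum_ite_eq, mem_univ, if_true]

theorem sum_mul_pow_repetitions_cons_le {q : α → ℝ} {μ ρ : ℝ} (hμ : 0 ≤ μ)
    (hqμ : ∀ x, q x ≤ μ) (hq1 : ∑ x, q x = 1) (hρ : 0 ≤ ρ) (u : Fin m → α) :
    ∑ x, q x * (1 + ρ) ^ repetitions (Fin.cons x u : Fin (m + 1) → α) ≤
      (1 + ρ * m * μ) * (1 + ρ) ^ repetitions u := by
  have hterm (x : α) : q x * (1 + ρ) ^ repetitions (Fin.cons x u : Fin (m + 1) → α) =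
      (q x + if occurrences u x ≠ 0 then q x * ρ else 0) * (1 + ρ) ^ repetitions u := by
    rw [repetitions_cons, pow_add]
    split_ifs <;> ring
  have hseen : ∑ x with occurrences u x ≠ 0, q x * ρ ≤ ρ * m * μ :=
    calc ∑ x with occurrences u x ≠ 0, q x * ρ
        ≤ ∑ x with occurrences u x ≠ 0, μ * ρ :=
          sum_le_sum fun x _ => mul_le_mul_of_nonneg_right (hqμ x) hρ
      _ = #{x | occurrences u x ≠ 0} * (μ * ρ) := by rw [sum_const, nsmul_eq_mul]
      _ ≤ m * (μ * ρ) := by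
          gcongr
          exact card_occurrences_ne_zero_le u
      _ = ρ * m * μ := by ring
  simp only [hterm]
  rw [← sum_mul, sum_add_distrib, hq1, ← sum_filter]
  exact mul_le_mul_of_nonneg_right (add_le_add le_rfl hseen) (by positivity)

theorem iidSum_pow_repetitions_le {q : α → ℝ} {μ ρ : ℝ} (hq0 : ∀ x, 0 ≤ q x) (hμ : 0 ≤ μ)
    (hqμ : ∀ x, q x ≤ μ) (hq1 : ∑ x, q x = 1) (hρ : 0 ≤ ρ) :
    iidSum q m (fun u => (1 + ρ) ^ repetitions u) ≤ (1 + ρ * m * μ) ^ m := by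
  induction m with
  | zero => simp [iidSum_zero, repetitions, occurrences]
  | succ m ih =>
    rw [iidSum_succ]
    simp only [mul_iidSum, sum_iidSum]
    calc iidSum q m (fun u => ∑ x, q x * (1 + ρ) ^ repetitions (Fin.cons x u : Fin (m + 1) → α))
        ≤ iidSum q m (fun u => (1 + ρ * m * μ) * (1 + ρ) ^ repetitions u) :=
          iidSum_mono hq0 fun u => sum_mul_pow_repetitions_cons_le hμ hqμ hq1 hρ u
      _ = (1 + ρ * m * μ) * iidSum q m (fun u => (1 + ρ) ^ repetitions u) := (mul_iidSum ..).symm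
      _ ≤ (1 + ρ * m * μ) * (1 + ρ * m * μ) ^ m := by gcongr
      _ = (1 + ρ * m * μ) ^ (m + 1) := (pow_succ' _ _).symm
      _ ≤ (1 + ρ * (m + 1 : ℕ) * μ) ^ (m + 1) := by
          gcongr
          exact m.le_succ

end Occurrences

section Posterior

variable {ι : Type*} [Fintype ι] [DecidableEq ι] {m T : ℕ} {η lam ρ B : ℝ}

/-- The likelihood of the heavy set `θ` when the blocks on the tapes `u` and `v` have been
observed. -/
def tapeLikelihood (η lam : ℝ) (u : Fin m → ι) (v : Fin T → ι) (θ : Finset ι) : ℝ :=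
  blockLikelihood η lam (fun j => occurrences u j + occurrences v j) θ

theorem prod_blockMass_mul_prod_blockMass (η lam : ℝ) (θ : Finset ι) (u : Fin m → ι)
    (v : Fin T → ι) :
    (∏ s, blockMass η lam θ (u s)) * ∏ s, blockMass η lam θ (v s) =
      tapeLikelihood η lam u v θ := by
  simp only [prod_comp_eq_prod_pow_occurrences, tapeLikelihood, blockLikelihood, pow_add,
    prod_mul_distrib]

theorem card_occurrences_add_ne_zero_le (u : Fin m → ι) (v : Fin T → ι) :
    #{j | occurrences u j + occurrences v j ≠ 0} ≤ m + T := by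
  have hsub : ({j | occurrences u j + occurrences v j ≠ 0} : Finset ι) ⊆
      (univ.filter fun j => occurrences u j ≠ 0) ∪ univ.filter fun j => occurrences v j ≠ 0 :=
    fun j => by
    simp only [mem_filter, mem_union, mem_univ, true_and]
    omega
  exact (card_le_card hsub).trans ((card_union_le _ _).trans
    (add_le_add (card_occurrences_ne_zero_le u) (card_occurrences_ne_zero_le v)))

theorem one_add_pow_sub_one_mul_sq_le {D Λ : ℝ} (hB : 1 ≤ B) (hΛ0 : 0 ≤ Λ) (hΛ1 : Λ ≤ 1)
    (hBΛ : B * Λ ^ 2 ≤ 1) (hρ : B * Λ ^ 4 * D ^ 2 ≤ ρ) (x y : ℕ) :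
    1 + (B ^ (x - 1) - 1) * (Λ ^ (x + y) * D) ^ 2 ≤ (1 + ρ) ^ (x - 1) := by
  have hρ0 : 0 ≤ ρ := le_trans (by positivity) hρ
  obtain hx | ⟨x, rfl⟩ : x - 1 = 0 ∨ ∃ x', x = x' + 2 := by
    rcases x with _ | _ | x
    exacts [.inl rfl, .inl rfl, .inr ⟨x, rfl⟩]
  · simp [hx]
  have hle : (B ^ (x + 1) - 1) * (Λ ^ (x + 2 + y) * D) ^ 2 ≤ ρ :=
    calc (B ^ (x + 1) - 1) * (Λ ^ (x + 2 + y) * D) ^ 2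
        ≤ B ^ (x + 1) * (Λ ^ (x + 2 + y) * D) ^ 2 := by gcongr; linarith
      _ = (B * Λ ^ 2) ^ x * (Λ ^ y) ^ 2 * (B * Λ ^ 4 * D ^ 2) := by ring
      _ ≤ 1 * (B * Λ ^ 4 * D ^ 2) := by
          gcongr
          exact mul_le_one₀ (pow_le_one₀ (by positivity) hBΛ) (sq_nonneg _)
            (pow_le_one₀ (by positivity) (pow_le_one₀ hΛ0 hΛ1))
      _ ≤ ρ := by rwa [one_mul]
  calc 1 + (B ^ (x + 1) - 1) * (Λ ^ (x + 2 + y) * D) ^ 2 ≤ 1 + ρ := by gcongr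
    _ ≤ (1 + ρ) ^ (x + 1) := le_self_pow₀ (by linarith) x.succ_ne_zero

-- A block that is seen twice is light for two independent posterior samples of the heavy set only
-- with probability of order `(lam / η) ^ 4`.
theorem sum_sum_tapeLikelihood_mul_prod_le {K : ℕ} (hη : 0 < η) (hlam : 0 < lam) (hle : lam ≤ η)
    (hmK : 2 * (m + T) ≤ K) (hK : 0 < K) (hB : 1 ≤ B) (hBΛ : B * (lam / η) ^ 2 ≤ 1)
    (hρ : B * (lam / η) ^ 4 * (2 * Fintype.card ι / K) ^ 2 ≤ ρ) (u : Fin m → ι) (v : Fin T → ι) :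
    ∑ θ ∈ powersetCard K univ, ∑ θ' ∈ powersetCard K univ,
      tapeLikelihood η lam u v θ * tapeLikelihood η lam u v θ' *
        ∏ j, (if j ∉ θ ∧ j ∉ θ' then B ^ (occurrences u j - 1) else 1) ≤
      (1 + ρ) ^ repetitions u * (∑ θ ∈ powersetCard K univ, tapeLikelihood η lam u v θ) ^ 2 := by
  have hseen := (Nat.mul_le_mul_left 2 (card_occurrences_add_ne_zero_le u v)).trans hmK
  have hφ (j : ι) : 1 ≤ B ^ (occurrences u j - 1) := one_le_pow₀ hB
  refine (sum_sum_mul_prod_ite_notMem_le (fun θ => (blockLikelihood_pos hη hlam _ θ).le) hφ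
    (sum_blockLikelihood_disjoint_le hη hlam hseen hK)).trans ?_
  refine mul_le_mul_of_nonneg_right ?_ (sq_nonneg _)
  rw [repetitions, ← prod_pow_eq_pow_sum]
  refine prod_le_prod (fun j _ => ?_) fun j _ => ?_
  · have := sub_nonneg.2 (hφ j)
    positivity
  · exact one_add_pow_sub_one_mul_sq_le hB (by positivity) ((div_le_one hη).2 hle) hBΛ hρ _ _

end Posterior

/-! ### Peaks in light blocks -/

section LightPeak

variable {ι β : Type*} [DecidableEq ι] [Fintype β] [DecidableEq β]

/-- The density, with respect to the uniform law on the positions, of the position in block `j`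
when a light block `j` is concentrated at its point `z j` and the heavy blocks are uniform. -/
def lightPeak (θ : Finset ι) (z : ι → β) (j : ι) (p : β) : ℝ :=
  if j ∈ θ then 1 else peak (z j) p

theorem lightPeak_nonneg (θ : Finset ι) (z : ι → β) (j : ι) (p : β) : 0 ≤ lightPeak θ z j p := by
  unfold lightPeak
  split_ifs
  exacts [zero_le_one, peak_nonneg _ _]

theorem expect_lightPeak (θ : Finset ι) (z : ι → β) (j : ι) : 𝔼 p, lightPeak θ z j p = 1 := by
  have : Nonempty β := ⟨z j⟩
  unfold lightPeak
  split_ifs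
  exacts [Fintype.expect_const _, expect_peak _]

theorem expect_lightPeak_mul_lightPeak (θ θ' : Finset ι) (z z' : ι → β) (j : ι) :
    𝔼 p, lightPeak θ z j p * lightPeak θ' z' j p =
      if j ∉ θ ∧ j ∉ θ' then peak (z j) (z' j) else 1 := by
  by_cases hj : j ∈ θ
  · simpa [hj, lightPeak] using expect_lightPeak θ' z' j
  · by_cases hj' : j ∈ θ'
    · simpa [hj', lightPeak] using expect_lightPeak θ z j
    · simpa [lightPeak, hj, hj', peak_comm (z j)] using expect_peak_mul_peak (z j) (z' j)

theorem expect_peak_pow (p₀ : β) (c : ℕ) :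
    𝔼 p, peak p₀ p ^ c = (Fintype.card β : ℝ) ^ (c - 1) := by
  have : Nonempty β := ⟨p₀⟩
  rcases c with _ | c
  · simp
  · simp only [pow_succ', expect_peak_mul p₀ fun p => peak p₀ p ^ c, peak_self,
      add_tsub_cancel_right]

variable {m : ℕ}

theorem expect_prod_lightPeak (θ : Finset ι) (z : ι → β) (u : Fin m → ι) :
    𝔼 p : Fin m → β, ∏ s, lightPeak θ z (u s) (p s) = 1 := by
  simp [expect_prod_pi fun (s : Fin m) p => lightPeak θ z (u s) p, expect_lightPeak]

variable [Fintype ι]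

theorem expect_expect_prod_lightPeak (θ θ' : Finset ι) (z : ι → β) (u : Fin m → ι) :
    𝔼 z' : ι → β, 𝔼 p : Fin m → β,
      (∏ s, lightPeak θ z (u s) (p s)) * ∏ s, lightPeak θ' z' (u s) (p s) =
        ∏ j, if j ∉ θ ∧ j ∉ θ' then (Fintype.card β : ℝ) ^ (occurrences u j - 1) else 1 := by
  have hpos (z' : ι → β) : 𝔼 p : Fin m → β,
      (∏ s, lightPeak θ z (u s) (p s)) * ∏ s, lightPeak θ' z' (u s) (p s) =
        ∏ j, (if j ∉ θ ∧ j ∉ θ' then peak (z j) (z' j) else 1) ^ occurrences u j := by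
    simp only [← prod_mul_distrib, ← expect_lightPeak_mul_lightPeak]
    rw [expect_prod_pi fun (s : Fin m) p => lightPeak θ z (u s) p * lightPeak θ' z' (u s) p,
      prod_comp_eq_prod_pow_occurrences fun j => 𝔼 p, lightPeak θ z j p * lightPeak θ' z' j p]
  simp only [hpos]
  rw [expect_prod_pi fun j p => (if j ∉ θ ∧ j ∉ θ' then peak (z j) p else 1) ^ occurrences u j]
  refine prod_congr rfl fun j _ => ?_
  have : Nonempty β := ⟨z j⟩
  split_ifs
  · exact expect_peak_pow _ _
  · simp

theorem sum_mul_expect_lightPeak_test_le [Nonempty β] {F : Finset (Finset ι)} {w : Finset ι → ℝ}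
    (hw : 0 < ∑ θ ∈ F, w θ) (u : Fin m → ι) {Φ : ℝ}
    (hΦ : ∑ θ ∈ F, ∑ θ' ∈ F, w θ * w θ' *
        ∏ j, (if j ∉ θ ∧ j ∉ θ' then (Fintype.card β : ℝ) ^ (occurrences u j - 1) else 1) ≤
      Φ * (∑ θ ∈ F, w θ) ^ 2)
    {g : (Fin m → β) → ℝ} (hg : ∀ p, g p ∈ Set.Icc 0 1) :
    ∑ θ ∈ F, w θ * 𝔼 z : ι → β, 𝔼 p, (∏ s, lightPeak θ z (u s) (p s)) * g p ≤
      (∑ θ ∈ F, w θ) * (𝔼 p, g p + (Φ - 1) + 1 / 4) := by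
  set X : (Fin m → β) → ℝ := fun p =>
    ∑ θ ∈ F, w θ * 𝔼 z : ι → β, ∏ s, lightPeak θ z (u s) (p s)
  have hX : 𝔼 p, X p = ∑ θ ∈ F, w θ := by
    rw [expect_sum_comm]
    refine sum_congr rfl fun θ _ => ?_
    rw [← mul_expect, expect_comm]
    simp only [expect_prod_lightPeak, Fintype.expect_const, mul_one]
  have hX2 : 𝔼 p, X p ^ 2 ≤ (1 + (Φ - 1)) * (∑ θ ∈ F, w θ) ^ 2 := by
    rw [add_sub_cancel]
    refine le_of_eq_of_le ?_ hΦ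
    simp only [X, sq, sum_mul_sum, mul_mul_mul_comm (w _)]
    rw [expect_sum_comm]
    refine sum_congr rfl fun θ _ => ?_
    rw [expect_sum_comm]
    refine sum_congr rfl fun θ' _ => ?_
    rw [← mul_expect]
    congr 1
    simp only [expect_mul_expect]
    rw [expect_comm]
    refine (expect_congr rfl fun z _ => ?_).trans (Fintype.expect_const _)
    rw [expect_comm, expect_expect_prod_lightPeak]
  refine le_of_eq_of_le ?_ (expect_mul_test_le hw hX hX2 hg)
  simp only [X, sum_mul, mul_assoc, expect_mul]
  rw [expect_sum_comm]
  refine sum_congr rfl fun θ _ => ?_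
  rw [← mul_expect, expect_comm]

end LightPeak
section MaskedLaw

variable {ι β : Type*} [DecidableEq ι] [Fintype β] {η lam : ℝ} {θ : Finset ι} {m T : ℕ}

/-- The law on the blocks `{j} × β` in which the blocks in `θ` are heavy and the position inside a
block is uniform. -/
noncomputable def blockLaw (η lam : ℝ) (θ : Finset ι) (x : ι × β) : ℝ :=
  blockMass η lam θ x.1 * (Fintype.card β : ℝ)⁻¹

theorem blockLaw_nonneg (hη : 0 < η) (hlam : 0 < lam) (x : ι × β) : 0 ≤ blockLaw η lam θ x :=
  mul_nonneg (blockMass_pos hη hlam θ x.1).le (by positivity)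

variable [Fintype ι]

theorem sum_blockLaw_mul (θ : Finset ι) (f : ι × β → ℝ) :
    ∑ x, blockLaw η lam θ x * f x = ∑ j, blockMass η lam θ j * 𝔼 p, f (j, p) := by
  simp only [blockLaw, Fintype.sum_prod_type, mul_assoc, ← mul_sum,
    Fintype.expect_eq_sum_div_card, div_eq_inv_mul]

theorem iidSum_blockLaw_mul (L : ι × β → ℝ) (F : (Fin m → ι × β) → ℝ) :
    iidSum (fun x => blockLaw η lam θ x * L x) m F =
      ∑ u : Fin m → ι, (∏ s, blockMass η lam θ (u s)) *
        𝔼 p : Fin m → β, (∏ s, L (u s, p s)) * F fun s => (u s, p s) := by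
  rw [iidSum, ← (Equiv.arrowProdEquivProdArrow (Fin m) (fun _ => ι) fun _ => β).symm.sum_comp,
    Fintype.sum_prod_type]
  refine sum_congr rfl fun u _ => ?_
  simp only [blockLaw, Equiv.arrowProdEquivProdArrow, Equiv.coe_fn_symm_mk, prod_mul_distrib,
    prod_const, card_univ, Fintype.card_fin, mul_assoc, ← mul_sum, Fintype.expect_eq_sum_div_card,
    Fintype.card_fun, Nat.cast_pow, inv_pow, div_eq_inv_mul]

theorem twoTapeSum_blockLaw_mul (L : ι × β → ℝ) (G : (Fin m → ι × β) → (Fin T → ι × β) → ℝ) :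
    twoTapeSum (fun x => blockLaw η lam θ x * L x) m (blockLaw η lam θ) T G =
      ∑ u : Fin m → ι, ∑ v : Fin T → ι, tapeLikelihood η lam u v θ *
        𝔼 p : Fin m → β, (∏ s, L (u s, p s)) *
          𝔼 p' : Fin T → β, G (fun s => (u s, p s)) fun s => (v s, p' s) := by
  have hflat (F : (Fin T → ι × β) → ℝ) : iidSum (blockLaw η lam θ) T F =
      ∑ v : Fin T → ι, (∏ s, blockMass η lam θ (v s)) *
        𝔼 p' : Fin T → β, F fun s => (v s, p' s) := by
    simpa using iidSum_blockLaw_mul (fun _ => 1) F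
  simp only [twoTapeSum, iidSum_blockLaw_mul, hflat, ← prod_blockMass_mul_prod_blockMass]
  refine sum_congr rfl fun u _ => ?_
  simp only [mul_sum, expect_sum_comm]
  refine sum_congr rfl fun v _ => ?_
  rw [mul_assoc, mul_expect (a := ∏ s, blockMass η lam θ (v s))]
  simp only [mul_left_comm]

theorem twoTapeSum_blockLaw (G : (Fin m → ι × β) → (Fin T → ι × β) → ℝ) :
    twoTapeSum (blockLaw η lam θ) m (blockLaw η lam θ) T G =
      ∑ u : Fin m → ι, ∑ v : Fin T → ι, tapeLikelihood η lam u v θ *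
        𝔼 p : Fin m → β, 𝔼 p' : Fin T → β, G (fun s => (u s, p s)) fun s => (v s, p' s) := by
  simpa using twoTapeSum_blockLaw_mul (fun _ => 1) G

theorem twoTapeSum_blockMass (H : (Fin m → ι) → (Fin T → ι) → ℝ) :
    twoTapeSum (blockMass η lam θ) m (blockMass η lam θ) T H =
      ∑ u, ∑ v, tapeLikelihood η lam u v θ * H u v := by
  simp only [twoTapeSum, iidSum, mul_sum, ← mul_assoc, prod_blockMass_mul_prod_blockMass]

theorem twoTapeSum_pow_repetitions_le {ρ : ℝ} (hη : 0 < η) (hlam : 0 < lam) (hle : lam ≤ η)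
    (hρ : 0 ≤ ρ) (hmass : ∑ j, blockMass η lam θ j = 1) (hfin : (1 + ρ * m * η) ^ m ≤ 5 / 4) :
    twoTapeSum (blockMass η lam θ) m (blockMass η lam θ) T
      (fun u _ => (1 + ρ) ^ repetitions u - 1 + 1 / 4) ≤ 1 / 2 := by
  have hrep : iidSum (blockMass η lam θ) m (fun u => (1 + ρ) ^ repetitions u) ≤ 5 / 4 :=
    (iidSum_pow_repetitions_le (fun j => (blockMass_pos hη hlam θ j).le) hη.le
      (blockMass_le hle θ) hmass hρ).trans hfin
  have hconst := iidSum_const hmass m (-3 / 4)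
  simp only [twoTapeSum, iidSum_const hmass]
  simp only [iidSum] at hrep hconst ⊢
  simp only [mul_add, mul_sub, sum_add_distrib, sum_sub_distrib] at hrep hconst ⊢
  simp only [← sum_mul] at hrep hconst ⊢
  linarith

variable [DecidableEq β]

/-- The law on the blocks `{j} × β` in which the blocks in `θ` are heavy and uniform, while a light
block `j` is concentrated at its point `z j`.  Collisions in light blocks, which would reveal the
concentration, are masked by those in heavy blocks. -/
noncomputable def maskedLaw (η lam : ℝ) (θ : Finset ι) (z : ι → β) (x : ι × β) : ℝ :=
  blockLaw η lam θ x * lightPeak θ z x.1 x.2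

omit [Fintype ι] in
theorem maskedLaw_nonneg (hη : 0 < η) (hlam : 0 < lam) (z : ι → β) (x : ι × β) :
    0 ≤ maskedLaw η lam θ z x :=
  mul_nonneg (blockLaw_nonneg hη hlam x) (lightPeak_nonneg θ z _ _)

theorem sum_maskedLaw (z : ι → β) : ∑ x, maskedLaw η lam θ z x = ∑ j, blockMass η lam θ j := by
  simp only [maskedLaw, sum_blockLaw_mul θ fun x => lightPeak θ z x.1 x.2, expect_lightPeak,
    mul_one]

theorem sum_abs_maskedLaw_sub_blockLaw (hη : 0 < η) (hlam : 0 < lam) (z : ι → β) :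
    ∑ x, |maskedLaw η lam θ z x - blockLaw η lam θ x| =
      2 * ((Fintype.card ι - #θ) * lam * (1 - 1 / Fintype.card β)) := by
  have hpt (x : ι × β) : |maskedLaw η lam θ z x - blockLaw η lam θ x| =
      blockLaw η lam θ x * |lightPeak θ z x.1 x.2 - 1| := by
    rw [maskedLaw, ← mul_sub_one, abs_mul, abs_of_nonneg (blockLaw_nonneg hη hlam x)]
  have hblock (j : ι) : blockMass η lam θ j * 𝔼 p, |lightPeak θ z j p - 1| =
      blockMass 0 (2 * (lam * (1 - 1 / Fintype.card β))) θ j := by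
    by_cases hj : j ∈ θ
    · simp [lightPeak, blockMass, hj]
    · simp only [lightPeak, blockMass, hj, if_false, expect_abs_peak_sub_one]
      ring
  simp only [hpt, sum_blockLaw_mul θ fun x => |lightPeak θ z x.1 x.2 - 1|, hblock, sum_blockMass]
  ring

theorem expect_twoTapeSum_maskedLaw (G : (Fin m → ι × β) → (Fin T → ι × β) → ℝ) :
    𝔼 z : ι → β, twoTapeSum (maskedLaw η lam θ z) m (blockLaw η lam θ) T G =
      ∑ u : Fin m → ι, ∑ v : Fin T → ι, tapeLikelihood η lam u v θ *
        𝔼 z : ι → β, 𝔼 p : Fin m → β, (∏ s, lightPeak θ z (u s) (p s)) *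
          𝔼 p' : Fin T → β, G (fun s => (u s, p s)) fun s => (v s, p' s) := by
  have hz (z : ι → β) := twoTapeSum_blockLaw_mul (η := η) (lam := lam) (θ := θ)
    (fun x => lightPeak θ z x.1 x.2) G
  simp only [← maskedLaw.eq_def] at hz
  simp only [hz, expect_sum_comm, mul_expect]

theorem sum_tapeLikelihood_mul_test_le [Nonempty β] {K : ℕ} {ρ : ℝ} (hη : 0 < η)
    (hlam : 0 < lam) (hle : lam ≤ η) (hKN : K ≤ Fintype.card ι) (hmK : 2 * (m + T) ≤ K)
    (hK : 0 < K) (hβΛ : Fintype.card β * (lam / η) ^ 2 ≤ 1)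
    (hρ : Fintype.card β * (lam / η) ^ 4 * (2 * Fintype.card ι / K) ^ 2 ≤ ρ) (u : Fin m → ι)
    (v : Fin T → ι) {g : (Fin m → β) → ℝ} (hg : ∀ p, g p ∈ Set.Icc 0 1) :
    ∑ θ ∈ powersetCard K univ, tapeLikelihood η lam u v θ *
        𝔼 z : ι → β, 𝔼 p, (∏ s, lightPeak θ z (u s) (p s)) * g p ≤
      ∑ θ ∈ powersetCard K univ,
        (tapeLikelihood η lam u v θ * 𝔼 p, g p +
          tapeLikelihood η lam u v θ * ((1 + ρ) ^ repetitions u - 1 + 1 / 4)) := by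
  have hF : (powersetCard K (univ : Finset ι)).Nonempty := by
    rwa [powersetCard_nonempty, card_univ]
  have hβ : (1 : ℝ) ≤ Fintype.card β := by exact_mod_cast Fintype.card_pos
  have hW : 0 < ∑ θ ∈ powersetCard K univ, tapeLikelihood η lam u v θ :=
    sum_pos (fun θ _ => blockLikelihood_pos hη hlam _ θ) hF
  simp only [← mul_add, ← sum_mul, ← add_assoc]
  exact sum_mul_expect_lightPeak_test_le hW u
    (sum_sum_tapeLikelihood_mul_prod_le hη hlam hle hmK hK hβ hβΛ hρ u v) hg

theorem sum_expect_twoTapeSum_maskedLaw_le [Nonempty β] {K : ℕ} {ρ : ℝ} (hη : 0 < η)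
    (hlam : 0 < lam) (hle : lam ≤ η) (hKN : K ≤ Fintype.card ι) (hmK : 2 * (m + T) ≤ K)
    (hK : 0 < K) (hmass : K * η + (Fintype.card ι - K) * lam = 1)
    (hβΛ : Fintype.card β * (lam / η) ^ 2 ≤ 1)
    (hρ : Fintype.card β * (lam / η) ^ 4 * (2 * Fintype.card ι / K) ^ 2 ≤ ρ)
    (hfin : (1 + ρ * m * η) ^ m ≤ 5 / 4) {G : (Fin m → ι × β) → (Fin T → ι × β) → ℝ}
    (hG : ∀ xs ys, G xs ys ∈ Set.Icc 0 1) :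
    ∑ θ ∈ powersetCard K univ, 𝔼 z : ι → β,
      twoTapeSum (maskedLaw η lam θ z) m (blockLaw η lam θ) T G ≤
    ∑ θ ∈ powersetCard K univ,
      (twoTapeSum (blockLaw η lam θ) m (blockLaw η lam θ) T G + 1 / 2) := by
  set g : (Fin m → ι) → (Fin T → ι) → (Fin m → β) → ℝ := fun u v p =>
    𝔼 p' : Fin T → β, G (fun s => (u s, p s)) fun s => (v s, p' s)
  have hg (u v p) : g u v p ∈ Set.Icc 0 1 :=
    ⟨expect_nonneg fun _ _ => (hG _ _).1, expect_le univ_nonempty fun _ _ => (hG _ _).2⟩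
  calc ∑ θ ∈ powersetCard K univ, 𝔼 z : ι → β,
        twoTapeSum (maskedLaw η lam θ z) m (blockLaw η lam θ) T G
      = ∑ u, ∑ v, ∑ θ ∈ powersetCard K univ, tapeLikelihood η lam u v θ *
          𝔼 z : ι → β, 𝔼 p, (∏ s, lightPeak θ z (u s) (p s)) * g u v p := by
        simp only [expect_twoTapeSum_maskedLaw]
        rw [sum_comm]
        exact sum_congr rfl fun u _ => sum_comm
    _ ≤ ∑ u, ∑ v, ∑ θ ∈ powersetCard K univ,
        (tapeLikelihood η lam u v θ * 𝔼 p, g u v p +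
          tapeLikelihood η lam u v θ * ((1 + ρ) ^ repetitions u - 1 + 1 / 4)) :=
        sum_le_sum fun u _ => sum_le_sum fun v _ =>
          sum_tapeLikelihood_mul_test_le hη hlam hle hKN hmK hK hβΛ hρ u v (hg u v)
    _ = ∑ θ ∈ powersetCard K univ, (twoTapeSum (blockLaw η lam θ) m (blockLaw η lam θ) T G +
          twoTapeSum (blockMass η lam θ) m (blockMass η lam θ) T
            fun u _ => (1 + ρ) ^ repetitions u - 1 + 1 / 4) := by
        simp only [twoTapeSum_blockLaw, twoTapeSum_blockMass, ← sum_add_distrib]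
        rw [sum_comm' (t' := univ) (s' := fun _ => powersetCard K univ) (by simp)]
        exact sum_congr rfl fun u _ => sum_comm
    _ ≤ _ := by
        gcongr with θ hθ
        refine twoTapeSum_pow_repetitions_le hη hlam hle (le_trans (by positivity) hρ) ?_ hfin
        rw [sum_blockMass, mem_powersetCard_univ.1 hθ, hmass]

end MaskedLaw

section Extend

variable {α γ : Type*} [Fintype α] [Fintype γ] {e : α → γ}

theorem sum_extend_zero (he : Injective e) (p : α → ℝ) :
    ∑ x, extend e p 0 x = ∑ a, p a :=
  (Fintype.sum_of_injective e he p (extend e p 0) (fun _ hx => extend_apply' _ _ _ hx)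
    fun a => (he.extend_apply p 0 a).symm).symm

theorem sum_abs_extend_zero_sub_extend_zero (he : Injective e) (p q : α → ℝ) :
    ∑ x, |extend e p 0 x - extend e q 0 x| = ∑ a, |p a - q a| := by
  refine (Fintype.sum_of_injective e he _ _ (fun x hx => ?_) fun a => ?_).symm
  · rw [extend_apply' _ _ _ hx, extend_apply' _ _ _ hx, sub_self, abs_zero]
  · rw [he.extend_apply, he.extend_apply]

theorem iidSum_extend_zero (he : Injective e) (p : α → ℝ) (m : ℕ) (F : (Fin m → γ) → ℝ) :
    iidSum (extend e p 0) m F = iidSum p m fun xs => F (e ∘ xs) := by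
  refine (Fintype.sum_of_injective (e ∘ ·) he.comp_left _ _ (fun xs hxs => ?_) fun xs => ?_).symm
  · obtain ⟨s, hs⟩ : ∃ s, ¬ ∃ a, e a = xs s := by
      by_contra! hrange
      choose as has using hrange
      exact hxs ⟨as, funext has⟩
    rw [prod_eq_zero (mem_univ s) (extend_apply' _ _ _ hs), zero_mul]
  · simp only [comp_apply, he.extend_apply]

theorem twoTapeSum_extend_zero (he : Injective e) (p q : α → ℝ) (m T : ℕ)
    (G : (Fin m → γ) → (Fin T → γ) → ℝ) :
    twoTapeSum (extend e p 0) m (extend e q 0) T G =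
      twoTapeSum p m q T fun xs ys => G (e ∘ xs) (e ∘ ys) := by
  simp only [twoTapeSum, iidSum_extend_zero he]

omit [Fintype γ] in
theorem exists_pmf_toReal_eq_extend_zero [Finite γ] (he : Injective e) {p : α → ℝ}
    (h0 : ∀ a, 0 ≤ p a) (h1 : ∑ a, p a = 1) :
    ∃ P : PMF γ, (fun x => (P x).toReal) = extend e p 0 := by
  have := Fintype.ofFinite γ
  have hnonneg (x : γ) : 0 ≤ extend e p 0 x := by
    by_cases hx : ∃ a, e a = x
    · obtain ⟨a, rfl⟩ := hx
      simpa [he.extend_apply] using h0 a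
    · exact (extend_apply' p (0 : γ → ℝ) x hx).ge
  exact (exists_pmf_toReal_eq hnonneg ((sum_extend_zero he p).trans h1)).imp fun P hP => funext hP

end Extend

section BothUnknown

variable {n k q r T : ℕ} {A : RandomizedAlgorithm k n} {ε : ℝ}

theorem RandomizedAlgorithm.not_solvesBothUnknown_of_masked (hA : A.UsesAtMost T) {m : ℕ}
    (hqr : q * r ≤ k) (hq : 60 ≤ q) (hm : 20 * T ≤ q * (m + 1)) {N b K : ℕ} [NeZero b]
    (hNb : N * b ≤ n) (hKN : K ≤ N) (hmK : 2 * (m + T) ≤ K) (hK : 0 < K) {η lam ρ : ℝ}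
    (hη : 0 < η) (hlam : 0 < lam) (hle : lam ≤ η) (hmass : K * η + (N - K) * lam = 1)
    (hε : ε ≤ (N - K) * lam * (1 - 1 / b)) (hbΛ : b * (lam / η) ^ 2 ≤ 1)
    (hρ : b * (lam / η) ^ 4 * (2 * N / K) ^ 2 ≤ ρ) (hfin : (1 + ρ * m * η) ^ m ≤ 5 / 4) :
    ¬ A.SolvesBothUnknown r ε := by
  intro hsol
  obtain ⟨e⟩ : Nonempty ((Fin N × Fin b) ↪ Fin n) :=
    Embedding.nonempty_of_card_le (by simpa using hNb)
  set F := powersetCard K (univ : Finset (Fin N))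
  have : Nonempty F := (powersetCard_nonempty.2 (by simpa using hKN)).to_subtype
  have hsum (θ : F) : ∑ j, blockMass η lam θ.1 j = 1 := by
    simpa [sum_blockMass, mem_powersetCard_univ.1 θ.2] using hmass
  have hblock (θ : F) : ∑ x : Fin N × Fin b, blockLaw η lam θ.1 x = 1 := by
    simpa [hsum] using sum_blockLaw_mul (β := Fin b) (η := η) (lam := lam) θ.1 fun _ => 1
  choose Q hQ using fun θ : F => exists_pmf_toReal_eq_extend_zero e.injective
    (blockLaw_nonneg (β := Fin b) hη hlam) (hblock θ)
  choose P hP using fun ω : F × (Fin N → Fin b) => exists_pmf_toReal_eq_extend_zero e.injective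
    (maskedLaw_nonneg hη hlam ω.2) ((sum_maskedLaw ω.2).trans (hsum ω.1))
  have htv (ω : F × (Fin N → Fin b)) : ε ≤ tvDist (P ω) (Q ω.1) := by
    refine hε.trans_eq ?_
    simp only [tvDist, fun ω x => congrFun (hP ω) x, fun θ x => congrFun (hQ θ) x,
      sum_abs_extend_zero_sub_extend_zero e.injective, sum_abs_maskedLaw_sub_blockLaw hη hlam,
      mem_powersetCard_univ.1 ω.1.2, Fintype.card_fin]
    ring
  obtain ⟨G, hG, hlt⟩ := A.exists_distinguishing_test hA hqr hq hm P (fun ω => Q ω.1)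
    fun I ω hI => hsol I _ _ hI (htv ω)
  have hle := sum_expect_twoTapeSum_maskedLaw_le (ι := Fin N) (β := Fin b) hη hlam hle
    (by simpa using hKN) hmK hK (by simpa using hmass) (by simpa using hbΛ) (by simpa using hρ)
    hfin (G := fun xs ys => G (e ∘ xs) (e ∘ ys)) fun xs ys => hG _ _
  refine hlt.not_ge ?_
  simp only [hP, hQ, twoTapeSum_extend_zero e.injective]
  rw [← univ_product_univ, expect_product, expect_product]
  simp only [Fintype.expect_const]
  rw [← expect_const (s := univ (α := F)) univ_nonempty (1 / 2 : ℝ), ← expect_add_distrib,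
    Fintype.expect_eq_sum_div_card, Fintype.expect_eq_sum_div_card]
  rw [← sum_coe_sort F, ← sum_coe_sort F] at hle
  exact div_le_div_of_nonneg_right hle (by positivity)

theorem tvDist_pure {x y : Fin n} (h : x ≠ y) : tvDist (PMF.pure x) (PMF.pure y) = 1 := by
  have hpt (z : Fin n) : |(PMF.pure x z).toReal - (PMF.pure y z).toReal| =
      (if z = x then 1 else 0) + if z = y then 1 else 0 := by
    by_cases hx : z = x
    · simp [PMF.pure_apply, hx, h]
    · by_cases hy : z = y <;> simp [PMF.pure_apply, hx, hy, h.symm]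
  simp only [tvDist, hpt, sum_add_distrib, sum_ite_eq', mem_univ, if_true]
  norm_num

-- Without a sample from the smaller cluster nothing distinguishes its indices.
theorem RandomizedAlgorithm.SolvesBothUnknown.lt_samples (hsol : A.SolvesBothUnknown r ε)
    (hn : 2 ≤ n) (hε : ε ≤ 1) (hA : A.UsesAtMost T) (hqr : q * r ≤ k) (hq : 60 ≤ q) :
    q < 20 * T := by
  by_contra! hT
  obtain ⟨G, -, hlt⟩ := A.exists_distinguishing_test (m := 0) (Ω := Unit) hA hqr hq (by simpa)
    (fun _ => PMF.pure ⟨0, by omega⟩) (fun _ => PMF.pure ⟨1, by omega⟩) fun I _ hI =>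
      hsol I _ _ hI (hε.trans_eq (tvDist_pure (by simp [Fin.ext_iff])).symm)
  simp only [twoTapeSum, iidSum_zero] at hlt
  linarith

theorem RandomizedAlgorithm.SolvesBothUnknown.solvesOneKnown [NeZero n]
    (hsol : A.SolvesBothUnknown r ε) : A.SolvesOneKnown r ε :=
  fun I P hI hP => hsol I P _ hI hP

end BothUnknown

/-! ### Choice of parameters -/

section Parameters

theorem exists_blocks {n B : ℕ} {ε : ℝ} (hn : 2 ≤ n) (hB : 2 ≤ B) (hεB : ε ≤ 1 - 2 / B)
    (hεn : ε ≤ 1 - 1 / n) :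
    ∃ h b : ℕ, 1 ≤ h ∧ 2 ≤ b ∧ b ≤ B ^ 2 ∧ h * b ≤ n ∧ n ≤ 2 * (h * b) ∧ ε * n ≤ h * (b - 1) := by
  have hB0 : (0 : ℝ) < B := by positivity
  by_cases hnB : n ≤ B ^ 2
  · refine ⟨1, n, le_rfl, hn, hnB, by omega, by omega, ?_⟩
    calc ε * n ≤ (1 - 1 / n) * n := by gcongr
      _ = (1 : ℕ) * (n - 1) := by field_simp; simp
  · push Not at hnB
    have hBh : B ≤ n / B := by
      rw [Nat.le_div_iff_mul_le (by omega)]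
      nlinarith
    have hdiv : n < B * (n / B + 1) := Nat.lt_mul_div_succ n (by omega)
    refine ⟨n / B, B, by omega, hB, Nat.le_self_pow two_ne_zero B, Nat.div_mul_le_self n B,
      by nlinarith, ?_⟩
    have hBh' : (B : ℝ) ≤ (n / B : ℕ) := by exact_mod_cast hBh
    have hdiv' : (n : ℝ) ≤ B * ((n / B : ℕ) + 1) := by exact_mod_cast hdiv.le
    have hB2 : (2 : ℝ) ≤ B := by exact_mod_cast hB
    calc ε * n ≤ (1 - 2 / B) * n := by gcongr
      _ ≤ (1 - 2 / B) * (B * ((n / B : ℕ) + 1)) := by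
        gcongr
        rw [sub_nonneg, div_le_one hB0]
        exact hB2
      _ = (B - 2) * ((n / B : ℕ) + 1) := by field_simp
      _ ≤ (n / B : ℕ) * (B - 1) := by linarith

theorem exists_block_peaks {n B : ℕ} {ε : ℝ} (hn : 2 ≤ n) (hB : 2 ≤ B) (hε : 0 < ε)
    (hεB : ε ≤ 1 - 2 / B) (hεn : ε ≤ 1 - 1 / n) :
    ∃ h b : ℕ, 1 ≤ h ∧ 1 ≤ b ∧ b ≤ B ^ 2 ∧ h * b ≤ n ∧
      ∃ a : ℝ, 0 ≤ a ∧ a ≤ 1 ∧ a ≤ 4 * ε ∧ ε ≤ a * h * (b - 1) / n := by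
  obtain ⟨h, b, hh, hb, hbB, hhb, hn2, hεh⟩ := exists_blocks hn hB hεB hεn
  have hn0 : (0 : ℝ) < n := by positivity
  have hb' : (2 : ℝ) ≤ b := by exact_mod_cast hb
  have hh' : (1 : ℝ) ≤ h := by exact_mod_cast hh
  have hn2' : (n : ℝ) ≤ 2 * (h * b) := by exact_mod_cast hn2
  have hD : 0 < (h : ℝ) * (b - 1) := mul_pos (by linarith) (by linarith)
  refine ⟨h, b, hh, by omega, hbB, hhb, ε * n / (h * (b - 1)), by positivity,
    (div_le_one hD).2 hεh, ?_, ?_⟩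
  · rw [div_le_iff₀ hD, mul_comm 4 ε, mul_assoc ε]
    gcongr
    nlinarith
  · rw [mul_assoc, div_mul_cancel₀ _ hD.ne', mul_div_cancel_right₀ _ hn0.ne']

theorem block_exponent_bounds {B b m n a ε t : ℝ} (hB : 1 ≤ B) (hb : 0 ≤ b) (hbB : b ≤ B ^ 2)
    (hm : 0 ≤ m) (hn : 1 ≤ n) (ha0 : 0 ≤ a) (haε : a ≤ 4 * ε)
    (hmε : m * ε ^ 2 * (50 * B ^ 4) ≤ √n) (ht : t = m * a ^ 2 * b / n) :
    t * b ≤ 1 ∧ t ^ 2 * n ≤ 1 / 5 := by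
  have hs1 : 1 ≤ √n := Real.one_le_sqrt.2 hn
  have hB1 : 1 ≤ B ^ 2 := one_le_pow₀ hB
  have ht0 : 0 ≤ t := by rw [ht]; positivity
  have hmain : t * √n * B ^ 2 ≤ 1 / 3 := by
    calc t * √n * B ^ 2 = m * a ^ 2 * b * B ^ 2 / √n := by
          rw [ht, div_mul_eq_mul_div, mul_div_assoc, Real.sqrt_div_self]
          ring
      _ ≤ m * (4 * ε) ^ 2 * B ^ 2 * B ^ 2 / √n := by gcongr
      _ = 16 / 50 * (m * ε ^ 2 * (50 * B ^ 4)) / √n := by ring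
      _ ≤ 16 / 50 * √n / √n := by gcongr
      _ ≤ 1 / 3 := by rw [mul_div_cancel_right₀ _ (by positivity)]; norm_num
  constructor
  · calc t * b ≤ t * (√n * B ^ 2) := by
          gcongr
          exact hbB.trans (le_mul_of_one_le_left (by positivity) hs1)
      _ ≤ 1 := by linarith
  · calc t ^ 2 * n = (t * √n) ^ 2 := by rw [mul_pow _ √_, Real.sq_sqrt (by positivity)]
      _ ≤ (t * √n * B ^ 2) ^ 2 := by
          have := le_mul_of_one_le_right (mul_nonneg ht0 (Real.sqrt_nonneg n)) hB1
          gcongr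
      _ ≤ (1 / 3) ^ 2 := by gcongr
      _ ≤ 1 / 5 := by norm_num

theorem block_count_bounds {B n T K : ℕ} (hB : 2 ≤ B) (hT : 1 ≤ T)
    (hTn : 1000 * B ^ 3 * T < n) (hKT : K ≤ 4 * T) :
    n ≤ 2 * (B * (n / B)) ∧ 4 * B ^ 2 * K ≤ n / B := by
  have hN : 16 * B ^ 2 * T ≤ n / B := by
    rw [Nat.le_div_iff_mul_le (by omega)]
    nlinarith [Nat.zero_le (B ^ 3 * T)]
  have hN1 : 1 ≤ n / B := le_trans (by nlinarith [Nat.pow_le_pow_left hB 2]) hN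
  exact ⟨by nlinarith [Nat.lt_mul_div_succ n (by omega : 0 < B)], by nlinarith⟩

theorem lt_of_pow_three_lt_mul_sq {x y z : ℝ} (hy : 0 ≤ y) (hz : z ^ 2 ≤ y)
    (h : x ^ 3 < (y * z) ^ 2) : x < y := by
  refine lt_of_pow_lt_pow_left₀ 3 hy (h.trans_le ?_)
  calc (y * z) ^ 2 = y ^ 2 * z ^ 2 := mul_pow y z 2
    _ ≤ y ^ 2 * y := by gcongr
    _ = y ^ 3 := (pow_succ y 2).symm

theorem exists_block_masses {B K N : ℕ} {ε : ℝ} (hB : 2 ≤ B) (hε : 0 < ε) (hεB : ε ≤ 1 - 2 / B)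
    (hK : 0 < K) (hKN : 4 * B ^ 2 * K ≤ N) :
    ∃ η lam : ℝ, 0 < η ∧ 0 < lam ∧ K * η + (N - K) * lam = 1 ∧
      ε = (N - K) * lam * (1 - 1 / B) ∧ η ≤ 1 / K ∧ lam / η ≤ 4 * ε * B * K / N ∧
      lam / η ≤ 1 / B := by
  have hB' : (2 : ℝ) ≤ B := by exact_mod_cast hB
  have hK' : (0 : ℝ) < K := by exact_mod_cast hK
  have hKN' : 4 * (B : ℝ) ^ 2 * K ≤ N := by exact_mod_cast hKN
  have hKN2 : 2 * (K : ℝ) ≤ N := by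
    refine le_trans ?_ hKN'
    gcongr
    nlinarith
  have hN : (0 : ℝ) < N := by linarith
  have hε1 : ε ≤ 1 := hεB.trans (sub_le_self _ (by positivity))
  have hB1 : (0 : ℝ) < B - 1 := by linarith
  have hNK : (0 : ℝ) < N - K := by linarith
  obtain ⟨w, hw⟩ : ∃ w : ℝ, w = ε * B / (B - 1) := ⟨_, rfl⟩
  have hεB' : ε * B ≤ B - 2 := by
    calc ε * B ≤ (1 - 2 / B) * B := by gcongr
      _ = B - 2 := by field_simp
  have hw0 : 0 < w := by rw [hw]; positivity
  have hw2 : w ≤ 2 * ε := by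
    rw [hw, div_le_iff₀ hB1]
    nlinarith
  have hw1 : 1 ≤ B * (1 - w) := by
    have : w * (B - 1) = ε * B := by rw [hw, div_mul_cancel₀ _ hB1.ne']
    nlinarith
  have hw1' : 0 < 1 - w := pos_of_mul_pos_right (one_pos.trans_le hw1) (by positivity)
  have hratio : w / (N - K) / ((1 - w) / K) ≤ 4 * ε * B * K / N := by
    calc w / (N - K) / ((1 - w) / K) = w * K / ((N - K) * (1 - w)) := by field_simp
      _ ≤ 2 * ε * K / (N / 2 * (1 / B)) := by
          gcongr
          · linarith
          · rwa [div_le_iff₀' (by positivity)]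
      _ = 4 * ε * B * K / N := by field_simp; ring
  refine ⟨(1 - w) / K, w / (N - K), by positivity, by positivity, by field_simp; ring,
    by rw [hw]; field_simp, by gcongr; linarith, hratio, hratio.trans ?_⟩
  calc 4 * ε * B * K / N ≤ 4 * 1 * B * K / (4 * B ^ 2 * K) := by gcongr
    _ = 1 / B := by field_simp

theorem masked_exponent_le {B K N T m n Y ε η Λ : ℝ} (hB : 1 ≤ B) (hε : 0 < ε) (hn : 0 < n)
    (hY : 0 < Y) (hK : 0 < K) (hN : n / (2 * B) ≤ N) (hm0 : 0 ≤ m) (hT0 : 0 ≤ T) (hη0 : 0 ≤ η)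
    (hΛ0 : 0 ≤ Λ) (hΛ : Λ ≤ 4 * ε * B * K / N) (hη : η ≤ 1 / K) (hKT : K ≤ 4 * T)
    (hm : m * (ε ^ 2 * Y) ≤ 40 * T) (hT : (1000 * B ^ 3 * T) ^ 3 ≤ (n * Y) ^ 2) :
    m * (B * Λ ^ 4 * (2 * N / K) ^ 2 * m * η) ≤ 1 / 5 := by
  have hN0 : 0 < N := lt_of_lt_of_le (by positivity) hN
  calc m * (B * Λ ^ 4 * (2 * N / K) ^ 2 * m * η)
      = B * Λ ^ 4 * (2 * N / K) ^ 2 * m ^ 2 * η := by ring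
    _ ≤ B * (4 * ε * B * K / N) ^ 4 * (2 * N / K) ^ 2 * m ^ 2 * (1 / K) := by gcongr
    _ = 1024 * B ^ 5 * ε ^ 4 * K * m ^ 2 / N ^ 2 := by field_simp; ring
    _ ≤ 1024 * B ^ 5 * ε ^ 4 * (4 * T) * (40 * T / (ε ^ 2 * Y)) ^ 2 / (n / (2 * B)) ^ 2 := by
        gcongr
        rwa [le_div_iff₀ (by positivity)]
    _ = 26214400 * (B ^ 7 * T ^ 3) / (n * Y) ^ 2 := by field_simp; ring
    _ ≤ 1 / 5 := by
        rw [div_le_iff₀ (by positivity)]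
        have hpow : B ^ 7 * T ^ 3 ≤ B ^ 9 * T ^ 3 := by gcongr; norm_num
        nlinarith [pow_nonneg hT0 3]

theorem one_add_pow_le_five_fourths {m : ℕ} {x : ℝ} (hx0 : 0 ≤ x) (hx : m * x ≤ 1 / 5) :
    (1 + x) ^ m ≤ 5 / 4 :=
  calc (1 + x) ^ m ≤ Real.exp x ^ m := by gcongr; rw [add_comm]; exact Real.add_one_le_exp x
    _ = Real.exp (m * x) := (Real.exp_nat_mul x m).symm
    _ ≤ 5 / 4 := exp_le_five_fourths hx

theorem rpow_two_thirds_le {x y : ℝ} (hx : 0 ≤ x) (hy : 0 ≤ y) (hxy : x ^ 2 ≤ y ^ 3) :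
    x ^ (2 / 3 : ℝ) ≤ y := by
  refine le_of_pow_le_pow_left₀ three_ne_zero hy (le_of_eq_of_le ?_ hxy)
  rw [← Real.rpow_mul_natCast hx, ← Real.rpow_natCast]
  norm_num

variable {k r : ℕ}

theorem sixty_le_div (hr : 1 ≤ r) (hrk : (r : ℝ) ≤ k / 60) : 60 ≤ k / r := by
  rw [Nat.le_div_iff_mul_le hr]
  have : (60 * r : ℝ) ≤ k := by linarith
  exact_mod_cast this

theorem div_le_two_mul_div (hr : 1 ≤ r) (hrk : (r : ℝ) ≤ k / 60) :
    (k : ℝ) / r ≤ 2 * (k / r : ℕ) := by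
  have hfloor : (k : ℝ) / r < (k / r : ℕ) + 1 := by
    rw [← Nat.floor_div_eq_div (K := ℝ)]
    exact Nat.lt_floor_add_one _
  have hq : (60 : ℝ) ≤ (k / r : ℕ) := by exact_mod_cast sixty_le_div hr hrk
  linarith

theorem exists_tape_length (hr : 1 ≤ r) (hrk : (r : ℝ) ≤ k / 60) (T : ℕ) :
    ∃ m : ℕ, m ≤ T ∧ 20 * T ≤ k / r * (m + 1) ∧ m * ((k : ℝ) / r) ≤ 40 * T := by
  have hq := sixty_le_div hr hrk
  refine ⟨20 * T / (k / r), Nat.div_le_of_le_mul (by nlinarith),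
    (Nat.lt_mul_div_succ _ (by omega)).le, ?_⟩
  have hfloor : ((20 * T / (k / r) : ℕ) : ℝ) * (k / r : ℕ) ≤ 20 * T := by
    exact_mod_cast Nat.div_mul_le_self (20 * T) (k / r)
  nlinarith [div_le_two_mul_div hr hrk, (20 * T / (k / r)).cast_nonneg (α := ℝ)]

end Parameters

namespace RandomizedAlgorithm

variable {n k r B T : ℕ} {A : RandomizedAlgorithm k n} {ε : ℝ}

theorem SolvesOneKnown.mul_sqrt_le_samples [NeZero n] (hsol : A.SolvesOneKnown r ε)
    (hA : A.UsesAtMost T) (hn : 2 ≤ n) (hr : 1 ≤ r) (hrk : (r : ℝ) ≤ k / 60) (hB : 2 ≤ B)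
    (hε : 0 < ε) (hεB : ε ≤ 1 - 2 / B) (hεn : ε ≤ 1 - 1 / n) :
    k / (r * ε ^ 2) * √n ≤ 2000 * B ^ 4 * T := by
  by_contra! hT
  obtain ⟨m, -, hm, hmk⟩ := exists_tape_length hr hrk T
  obtain ⟨h, b, hh, hb, hbB, hhb, a, ha0, ha1, haε, hεa⟩ := exists_block_peaks hn hB hε hεB hεn
  have : NeZero h := ⟨by omega⟩
  have : NeZero b := ⟨by omega⟩
  have hk : (0 : ℝ) < k := by
    have : (1 : ℝ) ≤ r := by exact_mod_cast hr
    linarith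
  have hmε : m * ε ^ 2 * (50 * B ^ 4) ≤ √n := by
    refine le_of_mul_le_mul_right ?_ (show 0 < k / (r * ε ^ 2) by positivity)
    calc m * ε ^ 2 * (50 * B ^ 4) * (k / (r * ε ^ 2))
        = 50 * (B : ℝ) ^ 4 * (m * (k / r)) := by field_simp
      _ ≤ 50 * (B : ℝ) ^ 4 * (40 * T) := by gcongr
      _ ≤ √n * (k / (r * ε ^ 2)) := by linarith
  obtain ⟨htb, htn⟩ := block_exponent_bounds (by exact_mod_cast (by omega : 1 ≤ B)) b.cast_nonneg
    (by exact_mod_cast hbB) m.cast_nonneg (by exact_mod_cast (by omega : 1 ≤ n)) ha0 haε hmε rfl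
  exact not_solvesOneKnown_of_blocks hA (Nat.div_mul_le_self k r) (sixty_le_div hr hrk) hm hhb
    ha0 ha1 hεa rfl htb htn hsol

namespace SolvesBothUnknown

theorem div_le_samples (hsol : A.SolvesBothUnknown r ε) (hA : A.UsesAtMost T) (hn : 2 ≤ n)
    (hr : 1 ≤ r) (hrk : (r : ℝ) ≤ k / 60) (hε1 : ε ≤ 1) : (k : ℝ) / r ≤ 40 * T := by
  have hlt : ((k / r : ℕ) : ℝ) < 20 * T := by
    exact_mod_cast hsol.lt_samples hn hε1 hA (Nat.div_mul_le_self k r) (sixty_le_div hr hrk)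
  linarith [div_le_two_mul_div hr hrk]

theorem sq_le_samples_pow_three (hsol : A.SolvesBothUnknown r ε) (hA : A.UsesAtMost T)
    (hn : 2 ≤ n) (hr : 1 ≤ r) (hrk : (r : ℝ) ≤ k / 60) (hB : 2 ≤ B) (hε : 0 < ε)
    (hεB : ε ≤ 1 - 2 / B) (hkn : (k / (r * ε ^ 2)) ^ 2 ≤ (n : ℝ)) :
    (n * (k / (r * ε ^ 2))) ^ 2 ≤ (1000 * B ^ 3 * T : ℝ) ^ 3 := by
  by_contra! hT
  have hB' : (2 : ℝ) ≤ B := by exact_mod_cast hB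
  have hr' : (1 : ℝ) ≤ r := by exact_mod_cast hr
  have hk : (0 : ℝ) < k := by linarith
  have hq := sixty_le_div hr hrk
  have hε1 : ε ≤ 1 := hεB.trans (sub_le_self _ (by positivity))
  have hT1 : 1 ≤ T := by linarith [hsol.lt_samples hn hε1 hA (Nat.div_mul_le_self k r) hq]
  have hTn : 1000 * B ^ 3 * T < n := by
    exact_mod_cast lt_of_pow_three_lt_mul_sq n.cast_nonneg hkn hT
  obtain ⟨m, hmT, hm, hmk⟩ := exists_tape_length hr hrk T
  obtain ⟨K, hK⟩ : ∃ K, K = 2 * (m + T) := ⟨_, rfl⟩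
  have hK0 : 0 < K := by omega
  obtain ⟨hnN, hKN⟩ := block_count_bounds hB hT1 hTn (by omega : K ≤ 4 * T)
  obtain ⟨N, hN⟩ : ∃ N, N = n / B := ⟨_, rfl⟩
  rw [← hN] at hnN hKN
  obtain ⟨η, lam, hη, hlam, hmass, hεw, hηK, hΛ, hΛB⟩ := exists_block_masses hB hε hεB hK0 hKN
  have hle : lam ≤ η := (div_le_one hη).1 (hΛB.trans (div_le_self one_pos.le (by linarith)))
  have hbΛ : B * (lam / η) ^ 2 ≤ 1 := by
    calc B * (lam / η) ^ 2 ≤ B * (1 / B) ^ 2 := by gcongr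
      _ = 1 / (B : ℝ) := by field_simp
      _ ≤ 1 := div_le_self one_pos.le (by linarith)
  have hexp : m * (B * (lam / η) ^ 4 * (2 * N / K) ^ 2 * m * η) ≤ 1 / 5 := by
    refine masked_exponent_le (T := T) (n := n) (Y := k / (r * ε ^ 2)) (by linarith) hε
      (by positivity) (by positivity) (by positivity) ?_ m.cast_nonneg T.cast_nonneg hη.le
      (by positivity) hΛ hηK (by exact_mod_cast (by omega : K ≤ 4 * T)) ?_ hT.le
    · rw [div_le_iff₀ (by positivity), mul_comm, mul_assoc]
      exact_mod_cast hnN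
    · refine le_of_eq_of_le ?_ hmk
      field_simp
  have : NeZero B := ⟨by omega⟩
  exact not_solvesBothUnknown_of_masked hA (Nat.div_mul_le_self k r) hq hm
    (hN ▸ Nat.div_mul_le_self n B) (by nlinarith) hK.ge hK0 hη hlam hle hmass hεw.le hbΛ le_rfl
    (one_add_pow_le_five_fourths (by positivity) hexp) hsol

theorem mul_sqrt_le_samples (hsol : A.SolvesBothUnknown r ε) (hA : A.UsesAtMost T) (hn : 2 ≤ n)
    (hr : 1 ≤ r) (hrk : (r : ℝ) ≤ k / 60) (hB : 2 ≤ B) (hε : 0 < ε) (hεB : ε ≤ 1 - 2 / B) :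
    k / (r * ε ^ 2) * √n ≤ 2000 * B ^ 4 * T := by
  by_cases hεn : ε ≤ 1 - 1 / n
  · have : NeZero n := ⟨by omega⟩
    exact hsol.solvesOneKnown.mul_sqrt_le_samples hA hn hr hrk hB hε hεB hεn
  -- The sample space is bounded, so one sample per index is already the right order.
  push Not at hεn
  have hB' : (2 : ℝ) ≤ B := by exact_mod_cast hB
  have hn' : (2 : ℝ) ≤ n := by exact_mod_cast hn
  have hnB : (n : ℝ) ≤ B / 2 := by
    have : (2 : ℝ) / B < 1 / n := by linarith
    rw [div_lt_div_iff₀ (by positivity) (by positivity)] at this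
    linarith
  have hε2 : 1 / 2 ≤ ε := by
    have : 1 / (n : ℝ) ≤ 1 / 2 := by gcongr
    linarith
  calc k / (r * ε ^ 2) * √(n : ℝ) = k / r / ε ^ 2 * √(n : ℝ) := by rw [div_div]
    _ ≤ 40 * (T : ℝ) / (1 / 2) ^ 2 * (B / 2) := by
        gcongr
        · exact hsol.div_le_samples hA hn hr hrk (hεB.trans (sub_le_self _ (by positivity)))
        · exact (Real.sqrt_le_self_iff.2 (.inr (by linarith))).trans hnB
    _ = 80 * (B : ℝ) ^ 1 * T := by ring
    _ ≤ 2000 * (B : ℝ) ^ 4 * T := by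
        gcongr
        · norm_num
        · exact one_le_two.trans hB'
        · norm_num

theorem rpow_two_thirds_le_samples (hsol : A.SolvesBothUnknown r ε)
    (hA : A.UsesAtMost T) (hn : 2 ≤ n) (hr : 1 ≤ r) (hrk : (r : ℝ) ≤ k / 60) (hB : 2 ≤ B)
    (hε : 0 < ε) (hεB : ε ≤ 1 - 2 / B) :
    (n * (k / (r * ε ^ 2))) ^ (2 / 3 : ℝ) ≤ 2000 * B ^ 4 * T := by
  have hB' : (1 : ℝ) ≤ B := by exact_mod_cast (by omega : 1 ≤ B)
  refine rpow_two_thirds_le (by positivity) (by positivity) ?_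
  rcases le_total ((k / (r * ε ^ 2)) ^ 2) (n : ℝ) with hkn | hkn
  · refine (hsol.sq_le_samples_pow_three hA hn hr hrk hB hε hεB hkn).trans ?_
    gcongr <;> norm_num [hB']
  · calc (n * (k / (r * ε ^ 2))) ^ 2 = (√n * √n) * n * (k / (r * ε ^ 2)) ^ 2 := by
          rw [Real.mul_self_sqrt n.cast_nonneg]; ring
      _ ≤ (√n * (k / (r * ε ^ 2))) * n * (k / (r * ε ^ 2)) ^ 2 := by
          gcongr
          exact Real.sqrt_le_iff.2 ⟨by positivity, hkn⟩
      _ = (k / (r * ε ^ 2) * √n) ^ 3 := by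
          nth_rw 2 [← Real.sq_sqrt n.cast_nonneg]; ring
      _ ≤ (2000 * B ^ 4 * T) ^ 3 := pow_le_pow_left₀ (by positivity)
          (hsol.mul_sqrt_le_samples hA hn hr hrk hB hε hεB) 3

end SolvesBothUnknown

end RandomizedAlgorithm

theorem theorem4p1 (δ : ℝ) (hδ : 0 < δ) :
    ∃ c : ℝ, 0 < c ∧
      ∀ (n k r : ℕ) [NeZero n] (ε : ℝ),
        2 ≤ n → 60 ≤ k → 1 ≤ r → (r : ℝ) ≤ (k : ℝ) / 60 → 0 < ε → ε ≤ 1 - δ →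
        ∀ (A : RandomizedAlgorithm k n) (T : ℕ), A.UsesAtMost T →
          (ε ≤ 1 - 1 / (n : ℝ) → A.SolvesOneKnown r ε →
            c * ((k : ℝ) * Real.sqrt (n : ℝ) / ((r : ℝ) * ε ^ 2)) ≤ (T : ℝ)) ∧
          (A.SolvesBothUnknown r ε →
            c * max ((k : ℝ) * Real.sqrt (n : ℝ) / ((r : ℝ) * ε ^ 2))
                (((n : ℝ) * (k : ℝ) / ((r : ℝ) * ε ^ 2)) ^ ((2 : ℝ) / 3)) ≤ (T : ℝ)) := by
  obtain ⟨B, hB⟩ := exists_nat_ge (max (2 / δ) 2)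
  have hBδ : 2 / δ ≤ B := (le_max_left _ _).trans hB
  have hB2 : 2 ≤ B := by exact_mod_cast (le_max_right _ _).trans hB
  refine ⟨1 / (2000 * B ^ 4), by positivity, fun n k r _ ε hn _ hr hrk hε hεδ A T hA => ?_⟩
  have hεB : ε ≤ 1 - 2 / B :=
    hεδ.trans (sub_le_sub_left ((div_le_comm₀ hδ (by positivity)).1 hBδ) 1)
  simp only [one_div_mul_eq_div, div_le_iff₀' (by positivity : (0 : ℝ) < 2000 * B ^ 4),
    mul_div_right_comm (k : ℝ), mul_div_assoc (n : ℝ)]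
  exact ⟨fun hεn hsol => hsol.mul_sqrt_le_samples hA hn hr hrk hB2 hε hεB hεn,
    fun hsol => max_le (hsol.mul_sqrt_le_samples hA hn hr hrk hB2 hε hεB)
      (hsol.rpow_two_thirds_le_samples hA hn hr hrk hB2 hε hεB)⟩
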